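/- **Setting.** Let $N\ge 2$, let $U\subset\mathbb R^N$ be open, $g$ a Riemannian metric of class $C^2$ on $U$ and $\phi:U\to\mathbb R$ of class $C^2$; put $\Omega=\{\phi<0\}$, $\partial\Omega=\{\phi=0\}$, $\overline\Omega=\{\phi\le 0\}$, and assume that $\overline\Omega$ is homeomorphic to the closed $N$-disk. Let $\nabla\phi$ and $H^\phi$ be the gradient and Hessian of $\phi$ with respect to $g$. Let $\delta_0>0$ be such that $\phi^{-1}(]-\infty,\delta_0])$ is compact and, at every $q$ with $\phi(q)\in[-\delta_0,\delta_0]$, one has $\nabla\phi(q)\ne 0$ and $H^\phi(q)[v,v]<0$ for all $v\neq 0$ with $g(\nabla\phi(q),v)=0$ (strong concavity). Put $K_0=\max\{\|\nabla\phi(x)\|_g:\phi(x)\le\delta_0\}$. **Paths.** $H^1([0,1],\mathbb R^N)$ is the space of absolutely continuous curves with square integrable derivative, with its Hilbert topology, and $\mathcal Rx(s)=x(1-s)$. Let $\mathfrak M_0$ be the set of $x\in H^1([0,1],\mathbb R^N)$ with $x([0,1])\subset\phi^{-1}(]-\infty,\delta_0[)$ and $\phi(x(0)),\phi(x(1))\ge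 0$. Let $\mathcal I_x^0$ be the set of intervals $[a,b]\subset[0,1]$ with $x([a,b])\subset\overline\Omega$ and $x(a),x(b)\in\partial\Omega$, and $\mathcal I_x$ the set of its maximal elements. Let $G:\partial\Omega\times\partial\Omega\to H^1([0,1],\overline\Omega)$ be any continuous map such that $G(A,B)$ goes from $A$ to $B$, $G(A,B)(s)\in\Omega$ for $A\ne B$ and $0<s<1$, $G(A,A)\equiv A$, and $\mathcal RG(A,B)=G(B,A)$. Put $\mathfrak C=\{G(A,B)\}$, $\mathfrak C_0=\{G(A,A)\}$, $M_0=\sup_{x\in\mathfrak C}\int_0^1 g(\dot x,\dot x)\,ds$ and $$\mathfrak M=\Big\{x\in\mathfrak M_0:\tfrac12\int_a^b g(\dot x,\dot x)\,ds<M_0\ \ \forall[a,b]\in\mathcal I_x\Big\}.$$ **Not essential intervals.** Fix constants $\bar\gamma>0$, $0<\bar\delta<\delta_0$, $0<\sigma_1<\bar\delta/2$. Let $\pi:\phi^{-1}([-\delta_0,0])\to\partial\Omega$ be the projection along the flow of $\nabla\phi/\|\nabla\phi\|_g^2$. For $x\in\mathfrak M$, an interval $[\alpha,\beta]\subset[a,b]\in\mathcal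 I_x^0$ is *topologically not essential* if it is minimal with respect to the properties $\phi(x(\alpha))=\phi(x(\beta))=-\bar\delta$, $\phi\circ x\ge-\bar\delta$ on $[\alpha,\beta]$, $\phi(x(s))>-\bar\delta$ for some $s\in]\alpha,\beta[$, and if moreover $\max_{[\alpha,\beta]}\phi\circ x\ge-\sigma_1$ and $$\frac{\max\{\|x(\beta)-\pi(x(\alpha))\|,\ \|x(\alpha)-\pi(x(\beta))\|\}}{\|\pi(x(\alpha))-\pi(x(\beta))\|}\ge 1+\tfrac32\bar\gamma$$ (Euclidean norms; the quotient is $+\infty$ if $x(\alpha)=x(\beta)$). **Admissible homotopies.** Let $\mathcal H_1$ be the set of pairs $(\mathcal D,h)$ where $\mathcal D\subset\mathfrak C$ is closed and $\mathcal R$-invariant and $h:[0,1]\times\mathcal D\to\mathfrak M$ is continuous with: $h(0,x)=x$; $h(\tau,x)$ is a constant curve for all $x\in\mathcal D\cap\mathfrak C_0$; $h(\tau,\mathcal Rx)=\mathcal Rh(\tau,x)$; there is a partition $0=\tau_0<\dots<\tau_k=1$ such that on each $[\tau',\tau'']=[\tau_i,\tau_{i+1}]$ the homotopy $h$ is of one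 of the types A, B, C below; and, for all $\tau$, all $x\in\mathcal D$ and all $[a,b]\in\mathcal I_{h(\tau,x)}$, on every topologically not essential interval $[\alpha,\beta]\subset[a,b]$ for $h(\tau,x)$ one has $\phi(h(\tau,x)(s))\le-\sigma_1/2$. * Type A: for all $\tau_*\in[\tau',\tau'']$, $s\in[0,1]$, $x\in\mathcal D$, the function $\tau\mapsto\phi(h(\tau,x)(s))$ is strictly increasing on a neighbourhood of $\tau_*$ in $[\tau',\tau'']$ whenever either $\phi(h(\tau_*,x)(s))=0$, or $\phi(h(\tau_*,x)(s))=-\delta$ for some $\delta\in]0,\delta_0]$ and $s$ lies in an interval $[\alpha,\beta]\subset[0,1]$ such that $y=h(\tau_*,x)$ satisfies $\phi(y(\alpha))=\phi(y(\beta))=0$ and $\min_{[\alpha,\beta]}\phi\circ y=-\delta$. * Type B: $h(\tau,x)=h(\tau',x)\circ\Lambda(\tau,x)$ on $[\tau',\tau'']\times\mathcal D$, where $\Lambda:[\tau',\tau'']\times\mathcal D\to H^1([0,1],[0,1])$ is continuous, each $\Lambda(\tau,x)$ is strictly increasing with $\Lambda(\tau,x)(0)=0$ and $\Lambda(\tau,x)(1)=1$,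 and $\Lambda(\tau',x)(s)=s$. * Type C: for all $\tau\in[\tau',\tau'']$, $x\in\mathcal D$, $s\in[0,1]$: $h(\tau',x)(s)\notin\overline\Omega$ implies $h(\tau,x)(s)=h(\tau',x)(s)$, and $h(\tau',x)(s)\in\Omega$ implies $h(\tau,x)(s)\in\Omega$. Put $$\mathcal F(\mathcal D,h)=\sup\Big\{\tfrac{b-a}2\int_a^b g(\dot y,\dot y)\,ds:\ y=h(1,x),\ x\in\mathcal D,\ [a,b]\in\mathcal I_y\Big\}\in[0,\infty]\qquad(\sup\emptyset=0).$$ **Relative category and minimax levels.** For a topological space $X$ and closed sets $Y,F\subset X$, let $\mathrm{cat}_{X,Y}(F)$ be the least integer $k\ge0$ (and $\infty$ if there is none) such that $F\subset A_0\cup\dots\cup A_k$ with $A_i$ open in $X$, $F\cap Y\subset A_0$, and there are continuous maps $h_i:[0,1]\times A_i\to X$ with $h_i(0,x)=x$ such that: for $i\ge1$, $h_i$ takes values in $X\setminus Y$ and $h_i(1,\cdot)$ is constant with value in $X\setminus Y$; and $h_0(1,A_0)\subset Y$, $h_0(\tau,A_0\cap Y)\subset Y$ for all $\tau$. Let a tilde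 denote the image in the quotient of $\mathfrak C$ by the identification $x\sim\mathcal Rx$. For an integer $i\ge 1$ let $\Gamma_i$ be the set of closed $\mathcal R$-invariant $\mathcal D\subset\mathfrak C$ with $\mathrm{cat}_{\widetilde{\mathfrak C},\widetilde{\mathfrak C}_0}(\widetilde{\mathcal D})\ge i$, and $$c_i=\inf\{\mathcal F(\mathcal D,h):\ \mathcal D\in\Gamma_i,\ (\mathcal D,h)\in\mathcal H_1\}\in[0,\infty]\qquad(\inf\emptyset=\infty).$$ **Lemma.** One has $c_1\ge\frac12\left(\frac{3\delta_0}{4K_0}\right)^2>0$ and $c_1\le c_2\le\dots\le c_N$. -/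

import Mathlib

open MeasureTheory Set Topology
open scoped ENNReal

noncomputable section

namespace OrthogonalChords

/-! ### Sobolev curves on the unit interval -/

/-- Lebesgue measure on the unit interval. -/
abbrev unitMeasure : Measure ℝ := volume.restrict (Icc (0 : ℝ) 1)

/-- The Sobolev space `H¹([0,1], V)` of absolutely continuous curves with square integrable
(weak) derivative. Such a curve is determined by, and may be freely prescribed through, its
starting point `x(0)` and its derivative `ẋ ∈ L²`; it is recorded as the pair `(x(0), ẋ)`.
The product topology is the one given by any of the usual (equivalent) `H¹` norms. -/
abbrev H1Path (V : Type*) [NormedAddCommGroup V] : Type _ :=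
  V × Lp V 2 unitMeasure

namespace H1Path

variable {V : Type*} [NormedAddCommGroup V] [NormedSpace ℝ V]

/-- The value `x(s)` of an `H¹` curve at the time `s ∈ [0,1]`. -/
def curve (x : H1Path V) (s : ℝ) : V := x.1 + ∫ t in (0 : ℝ)..s, x.2 t

/-- The (a.e. defined) derivative `ẋ(s)`. -/
def vel (x : H1Path V) (s : ℝ) : V := x.2 s

lemma measurePreserving_flip :
    MeasurePreserving (fun t : ℝ => 1 - t) unitMeasure unitMeasure := by
  have h := (Measure.measurePreserving_sub_left (volume : Measure ℝ) 1).restrict_preimage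
    (measurableSet_Icc (a := (0 : ℝ)) (b := 1))
  have e : (fun t : ℝ => 1 - t) ⁻¹' Icc (0 : ℝ) 1 = Icc (0 : ℝ) 1 := by
    ext t
    simp only [mem_preimage, mem_Icc]
    constructor <;> rintro ⟨h1, h2⟩ <;> constructor <;> linarith
  rwa [e] at h

/-- Time reversal `(ℛx)(s) = x(1 - s)`: it starts at `x(1)` and has derivative `-ẋ(1 - s)`. -/
def reverse (x : H1Path V) : H1Path V :=
  (x.curve 1, -Lp.compMeasurePreserving (fun t : ℝ => 1 - t) measurePreserving_flip x.2)

lemma intervalIntegrable_vel (x : H1Path V) {a b : ℝ} (ha : a ∈ Icc (0 : ℝ) 1)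
    (hb : b ∈ Icc (0 : ℝ) 1) : IntervalIntegrable (fun t => x.2 t) volume a b := by
  have h : Integrable (fun t => x.2 t) unitMeasure :=
    (Lp.memLp x.2).integrable (by norm_num)
  rw [intervalIntegrable_iff]
  refine IntegrableOn.mono_set h ?_
  exact uIoc_subset_uIcc.trans (uIcc_subset_Icc ha hb)

lemma curve_reverse (x : H1Path V) {s : ℝ} (hs : s ∈ Icc (0 : ℝ) 1) :
    x.reverse.curve s = x.curve (1 - s) := by
  have hae : ∀ᵐ t ∂unitMeasure, x.reverse.2 t = -x.2 (1 - t) := by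
    have h1 := Lp.coeFn_compMeasurePreserving x.2
      (measurePreserving_flip)
    filter_upwards [Lp.coeFn_neg (Lp.compMeasurePreserving (fun t : ℝ => 1 - t)
      measurePreserving_flip x.2), h1] with t h2 h3
    simp only [reverse]
    rw [h2, Pi.neg_apply, h3]
    rfl
  have hint : ∫ t in (0 : ℝ)..s, x.reverse.2 t = ∫ t in (0 : ℝ)..s, -x.2 (1 - t) := by
    apply intervalIntegral.integral_congr_ae
    have h4 := (ae_restrict_iff' measurableSet_Icc).1 hae
    filter_upwards [h4] with t ht htm
    rw [uIoc_of_le hs.1] at htm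
    exact ht ⟨htm.1.le, htm.2.trans hs.2⟩
  have hadd : (∫ t in (0 : ℝ)..(1 - s), x.2 t) + ∫ t in (1 - s)..1, x.2 t
      = ∫ t in (0 : ℝ)..1, x.2 t := by
    have hm : (1 - s) ∈ Icc (0 : ℝ) 1 := ⟨by linarith [hs.2], by linarith [hs.1]⟩
    exact intervalIntegral.integral_add_adjacent_intervals
      (x.intervalIntegrable_vel (by simp) hm) (x.intervalIntegrable_vel hm (by simp))
  unfold curve at *
  rw [hint, intervalIntegral.integral_neg,
    intervalIntegral.integral_comp_sub_left (fun t => x.2 t) 1, sub_zero]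
  simp only [reverse, curve]
  rw [← hadd]
  abel

lemma reverse_reverse (x : H1Path V) : x.reverse.reverse = x := by
  refine Prod.ext ?_ ?_
  · change x.reverse.curve 1 = x.1
    rw [curve_reverse x (by simp)]
    simp [curve]
  · change -Lp.compMeasurePreserving (fun t : ℝ => 1 - t) measurePreserving_flip
      (-Lp.compMeasurePreserving (fun t : ℝ => 1 - t) measurePreserving_flip x.2) = x.2
    rw [map_neg, neg_neg]
    apply Lp.ext
    have h1 := Lp.coeFn_compMeasurePreserving x.2 measurePreserving_flip
    have h2 := Lp.coeFn_compMeasurePreserving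
      (Lp.compMeasurePreserving (fun t : ℝ => 1 - t) measurePreserving_flip x.2)
      measurePreserving_flip
    have h3 := measurePreserving_flip.quasiMeasurePreserving.ae h1
    filter_upwards [h2, h3] with t h4 h5
    rw [h4, Function.comp_apply, h5]
    simp

/-- A set of curves is `ℛ`-invariant. -/
def Invariant (D : Set (H1Path V)) : Prop := reverse '' D = D

/-- The curve is constant. -/
def IsConst (x : H1Path V) : Prop := ∀ s ∈ Icc (0 : ℝ) 1, x.curve s = x.curve 0

end H1Path

open H1Path

/-! ### Relative category -/

section RelativeCategory

variable {X : Type*} [TopologicalSpace X]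

/-- `F` is covered by open sets `A₀, …, A_k` of `X` such that `F ∩ Y ⊆ A₀`, the set `A₀` is
deformable in `X` into `Y` with `A₀ ∩ Y` staying in `Y`, and each of `A₁, …, A_k` is deformable
in `X \ Y` to a point of `X \ Y`. -/
def RelCoverable (Y F : Set X) (k : ℕ) : Prop :=
  ∃ (A : ℕ → Set X) (h : ℕ → ℝ → X → X),
    (F ⊆ ⋃ i ∈ Iic k, A i) ∧ (F ∩ Y ⊆ A 0) ∧
    (∀ i ≤ k, IsOpen (A i) ∧
      ContinuousOn (fun p : ℝ × X => h i p.1 p.2) (Icc (0 : ℝ) 1 ×ˢ A i) ∧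
      ∀ x ∈ A i, h i 0 x = x) ∧
    (∀ i, 1 ≤ i → i ≤ k →
      (∃ p ∈ Yᶜ, ∀ x ∈ A i, h i 1 x = p) ∧
      ∀ τ ∈ Icc (0 : ℝ) 1, ∀ x ∈ A i, h i τ x ∈ Yᶜ) ∧
    (∀ x ∈ A 0, h 0 1 x ∈ Y) ∧
    (∀ τ ∈ Icc (0 : ℝ) 1, ∀ x ∈ A 0 ∩ Y, h 0 τ x ∈ Y)

/-- The relative category `cat_{X,Y}(F)`: the least `k ∈ {0, 1, 2, …}` with a covering as above,
and `∞` if there is none. -/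
def relCat (Y F : Set X) : ℕ∞ :=
  ⨅ (k : ℕ) (_ : RelCoverable Y F k), (k : ℕ∞)

end RelativeCategory

/-! ### The geometric setting -/

section Riemannian

variable {E : Type*} [NormedAddCommGroup E] [NormedSpace ℝ E]

/-- The Riemannian gradient: the vector `∇φ(p)` with `g_p(∇φ(p), v) = dφ_p(v)` for all `v`. -/
def riemGrad (g : E → E →L[ℝ] E →L[ℝ] ℝ) (φ : E → ℝ) (p : E) : E :=
  (g p).inverse (fderiv ℝ φ p)

/-- The Riemannian Hessian `H^φ(p)(v,v) = D²φ(v,v) - dφ(Γ(v,v))` in linear coordinates. Here the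
Christoffel term is `dφ(Γ(v,v)) = g(Γ(v,v), ∇φ) = (D_v g)(v, ∇φ) - ½ (D_{∇φ} g)(v, v)`. -/
def riemHess (g : E → E →L[ℝ] E →L[ℝ] ℝ) (φ : E → ℝ) (p v : E) : ℝ :=
  fderiv ℝ (fderiv ℝ φ) p v v
    - (fderiv ℝ g p v v (riemGrad g φ p) - 1 / 2 * fderiv ℝ g p (riemGrad g φ p) v v)

end Riemannian

/-- A strongly concave Riemannian disk in linear coordinates, with a defining function: an open
set `U ⊆ ℝᴺ` with a `C²` Riemannian metric `g` and a `C²` function `φ : U → ℝ`, for which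
`Ω = {φ < 0}`, `∂Ω = {φ = 0}`, `Ω̄ = {φ ≤ 0}`, and a number `δ₀ > 0` as specified by the last
four fields. -/
structure ConcaveDisk (N : ℕ) where
  U : Set (EuclideanSpace ℝ (Fin N))
  isOpen_U : IsOpen U
  /-- the Riemannian metric -/
  g : EuclideanSpace ℝ (Fin N) →
    EuclideanSpace ℝ (Fin N) →L[ℝ] EuclideanSpace ℝ (Fin N) →L[ℝ] ℝ
  contDiffOn_g : ContDiffOn ℝ 2 g U
  g_symm : ∀ p ∈ U, ∀ v w, g p v w = g p w v
  g_pos : ∀ p ∈ U, ∀ v, v ≠ 0 → 0 < g p v v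
  /-- the function defining `Ω` -/
  φ : EuclideanSpace ℝ (Fin N) → ℝ
  contDiffOn_φ : ContDiffOn ℝ 2 φ U
  /-- `Ω̄` is homeomorphic to the closed `N`-disk -/
  disk : Nonempty ({p // p ∈ U ∧ φ p ≤ 0} ≃ₜ
    Metric.closedBall (0 : EuclideanSpace ℝ (Fin N)) 1)
  δ₀ : ℝ
  δ₀_pos : 0 < δ₀
  isCompact_sublevel : IsCompact {p | p ∈ U ∧ φ p ≤ δ₀}
  grad_ne_zero : ∀ p ∈ U, φ p ∈ Icc (-δ₀) δ₀ → riemGrad g φ p ≠ 0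
  /-- strong concavity: for `φ(p) = 0` this says that the second fundamental form of `∂Ω` in the
  inward normal direction is negative definite, and it persists on `φ⁻¹([-δ₀, δ₀])` -/
  hess_neg : ∀ p ∈ U, φ p ∈ Icc (-δ₀) δ₀ → ∀ v, v ≠ 0 →
    g p (riemGrad g φ p) v = 0 → riemHess g φ p v < 0

namespace ConcaveDisk

variable {N : ℕ} (S : ConcaveDisk N)

/-- The open set `Ω`. -/
def Omega : Set (EuclideanSpace ℝ (Fin N)) := {p | p ∈ S.U ∧ S.φ p < 0}

/-- The closure `Ω̄`. -/
def closedOmega : Set (EuclideanSpace ℝ (Fin N)) := {p | p ∈ S.U ∧ S.φ p ≤ 0}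

/-- The boundary `∂Ω`. -/
def bdry : Set (EuclideanSpace ℝ (Fin N)) := {p | p ∈ S.U ∧ S.φ p = 0}

/-- The Riemannian gradient of `φ`. -/
def grad (p : EuclideanSpace ℝ (Fin N)) : EuclideanSpace ℝ (Fin N) := riemGrad S.g S.φ p

/-- `K₀ = max ‖∇φ‖` over `φ⁻¹(]-∞, δ₀])`, the norm being that of `g`. -/
def K₀ : ℝ :=
  sSup ((fun p => Real.sqrt (S.g p (S.grad p) (S.grad p))) '' {p | p ∈ S.U ∧ S.φ p ≤ S.δ₀})

/-- `∫_a^b g(ẋ, ẋ) ds`. -/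
def energy (x : H1Path (EuclideanSpace ℝ (Fin N))) (a b : ℝ) : ℝ :=
  ∫ s in a..b, S.g (x.curve s) (x.vel s) (x.vel s)

/-- The path space `𝔐₀`. -/
def paths₀ : Set (H1Path (EuclideanSpace ℝ (Fin N))) :=
  {x | (∀ s ∈ Icc (0 : ℝ) 1, x.curve s ∈ S.U ∧ S.φ (x.curve s) < S.δ₀) ∧
    0 ≤ S.φ (x.curve 0) ∧ 0 ≤ S.φ (x.curve 1)}

/-- `[a,b] ∈ ℐ⁰ₓ`: an interval in `[0,1]` mapped to `Ω̄` with end points mapped to `∂Ω`. -/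
def IsInner (x : H1Path (EuclideanSpace ℝ (Fin N))) (a b : ℝ) : Prop :=
  0 ≤ a ∧ a ≤ b ∧ b ≤ 1 ∧ (∀ s ∈ Icc a b, x.curve s ∈ S.closedOmega) ∧
    x.curve a ∈ S.bdry ∧ x.curve b ∈ S.bdry

/-- `[a,b] ∈ ℐₓ`: a maximal element of `ℐ⁰ₓ`. -/
def IsMaxInner (x : H1Path (EuclideanSpace ℝ (Fin N))) (a b : ℝ) : Prop :=
  S.IsInner x a b ∧ ∀ a' b', S.IsInner x a' b' → a' ≤ a → b ≤ b' → a' = a ∧ b' = b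

/-- `[α,β]` is a `δ`-interval for `x`. -/
def IsDeltaInterval (δ : ℝ) (x : H1Path (EuclideanSpace ℝ (Fin N))) (α β : ℝ) : Prop :=
  0 ≤ α ∧ α ≤ β ∧ β ≤ 1 ∧ (∀ s ∈ Icc α β, -δ ≤ S.φ (x.curve s)) ∧
    S.φ (x.curve α) = 0 ∧ S.φ (x.curve β) = 0 ∧
    sInf ((fun s => S.φ (x.curve s)) '' Icc α β) = -δ

/-- `q` is reached from `y ∈ φ⁻¹([-δ₀, 0])` at the time `-φ(y)` along the flow of
`∇φ / ‖∇φ‖²`; as `φ` grows with unit speed along this flow, `q ∈ ∂Ω`. -/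
def FlowsTo (y q : EuclideanSpace ℝ (Fin N)) : Prop :=
  ∃ c : ℝ → EuclideanSpace ℝ (Fin N), c 0 = y ∧ c (-S.φ y) = q ∧
    ∀ t ∈ Icc 0 (-S.φ y), c t ∈ S.U ∧
      HasDerivWithinAt c ((S.g (c t) (S.grad (c t)) (S.grad (c t)))⁻¹ • S.grad (c t))
        (Icc 0 (-S.φ y)) t

open Classical in
/-- The projection `π : φ⁻¹([-δ₀, 0]) → ∂Ω` along the gradient flow of `φ`. -/
def proj (y : EuclideanSpace ℝ (Fin N)) : EuclideanSpace ℝ (Fin N) :=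
  if h : ∃ q, S.FlowsTo y q then h.choose else y

/-- The conditions on `[α,β]`, other than minimality, for `x` to be `δ`-close to `∂Ω` on
`[α,β]`. -/
def PreClose (δ : ℝ) (x : H1Path (EuclideanSpace ℝ (Fin N))) (α β : ℝ) : Prop :=
  S.φ (x.curve α) = -δ ∧ S.φ (x.curve β) = -δ ∧
    (∀ s ∈ Icc α β, -δ ≤ S.φ (x.curve s)) ∧ ∃ s ∈ Ioo α β, -δ < S.φ (x.curve s)

/-- `x` is `δ`-close to `∂Ω` on `[α,β]`. -/
def IsClose (δ : ℝ) (x : H1Path (EuclideanSpace ℝ (Fin N))) (α β : ℝ) : Prop :=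
  S.PreClose δ x α β ∧
    ∀ α' β', α ≤ α' → β' ≤ β → S.PreClose δ x α' β' → α' = α ∧ β' = β

/-- The maximal proximity of `x` to `∂Ω` on `[α,β]`. -/
def proximity (x : H1Path (EuclideanSpace ℝ (Fin N))) (α β : ℝ) : ℝ :=
  sSup ((fun s => S.φ (x.curve s)) '' Icc α β)

/-- The bending constant of `x` on `[α,β]`, with values in `[0, ∞]` (the denominator vanishes
only if `x(α) = x(β)`, and then the value is `∞`). -/
def bending (x : H1Path (EuclideanSpace ℝ (Fin N))) (α β : ℝ) : ℝ≥0∞ :=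
  ENNReal.ofReal (max ‖x.curve β - S.proj (x.curve α)‖ ‖x.curve α - S.proj (x.curve β)‖) /
    ENNReal.ofReal ‖S.proj (x.curve α) - S.proj (x.curve β)‖

/-- `[α,β]` is a topologically not essential interval for `x`, relative to constants
`δ̄, γ̄, σ₁`. -/
def IsNotEssential (δb γb σ₁ : ℝ) (x : H1Path (EuclideanSpace ℝ (Fin N))) (α β : ℝ) : Prop :=
  S.IsClose δb x α β ∧ -σ₁ ≤ S.proximity x α β ∧
    ENNReal.ofReal (1 + 3 / 2 * γb) ≤ S.bending x α β

/-- A continuous family `G` of `H¹` curves in `Ω̄` joining the points of `∂Ω`. -/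
structure ChordMap where
  toFun : S.bdry → S.bdry → H1Path (EuclideanSpace ℝ (Fin N))
  continuous : Continuous fun p : S.bdry × S.bdry => toFun p.1 p.2
  mem_closedOmega : ∀ A B, ∀ s ∈ Icc (0 : ℝ) 1, (toFun A B).curve s ∈ S.closedOmega
  curve_zero : ∀ A B, (toFun A B).curve 0 = A
  curve_one : ∀ A B, (toFun A B).curve 1 = B
  mem_Omega : ∀ A B, A ≠ B → ∀ s ∈ Ioo (0 : ℝ) 1, (toFun A B).curve s ∈ S.Omega
  curve_diag : ∀ A, ∀ s ∈ Icc (0 : ℝ) 1, (toFun A A).curve s = A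
  reverse_eq : ∀ A B, (toFun A B).reverse = toFun B A

namespace ChordMap

variable {S} (G : S.ChordMap)

/-- The set `𝔠 = {G(A,B)}`. -/
def chords : Set (H1Path (EuclideanSpace ℝ (Fin N))) := {x | ∃ A B, x = G.toFun A B}

/-- The set `𝔠₀ = {G(A,A)}` of constant chords. -/
def constChords : Set (H1Path (EuclideanSpace ℝ (Fin N))) := {x | ∃ A, x = G.toFun A A}

/-- The constant `M₀`. -/
def M₀ : ℝ := sSup ((fun x => S.energy x 0 1) '' G.chords)

/-- The path space `𝔐`. -/
def paths : Set (H1Path (EuclideanSpace ℝ (Fin N))) :=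
  {x | x ∈ S.paths₀ ∧ ∀ a b, S.IsMaxInner x a b → 1 / 2 * S.energy x a b < G.M₀}

/-- The equivalence relation on `𝔠` identifying `x` with `ℛx`. -/
def chordSetoid : Setoid G.chords where
  r x y := (y : H1Path (EuclideanSpace ℝ (Fin N))) = x ∨
    (y : H1Path (EuclideanSpace ℝ (Fin N))) = H1Path.reverse x
  iseqv :=
    { refl := fun _ => Or.inl rfl
      symm := by
        rintro x y (h | h)
        · exact Or.inl h.symm
        · exact Or.inr (by rw [h, reverse_reverse])
      trans := by
        rintro x y z (h | h) (h' | h')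
        · exact Or.inl (h'.trans h)
        · exact Or.inr (by rw [h', h])
        · exact Or.inr (h'.trans h)
        · exact Or.inl (by rw [h', h, reverse_reverse]) }

/-- The quotient of `𝔠` by `ℛ`, with the quotient topology. -/
abbrev ChordQuot : Type := Quotient G.chordSetoid

/-- The image in the quotient of a set of curves. -/
def toQuot (D : Set (H1Path (EuclideanSpace ℝ (Fin N)))) : Set G.ChordQuot :=
  Quotient.mk G.chordSetoid '' (Subtype.val ⁻¹' D)

/-- The closed `ℛ`-invariant subsets of `𝔠`. -/
def closedInvariant : Set (Set (H1Path (EuclideanSpace ℝ (Fin N)))) :=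
  {D | D ⊆ G.chords ∧ IsClosed D ∧ H1Path.Invariant D}

/-- The class `Γ_i`. -/
def Gam (i : ℕ) : Set (Set (H1Path (EuclideanSpace ℝ (Fin N)))) :=
  {D | D ∈ G.closedInvariant ∧ (i : ℕ∞) ≤ relCat (G.toQuot G.constChords) (G.toQuot D)}

end ChordMap

/-! ### Admissible homotopies -/

/-- `h` is of type A on `[τ₁, τ₂]`. -/
def TypeA (D : Set (H1Path (EuclideanSpace ℝ (Fin N))))
    (h : ℝ → H1Path (EuclideanSpace ℝ (Fin N)) → H1Path (EuclideanSpace ℝ (Fin N)))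
    (τ₁ τ₂ : ℝ) : Prop :=
  ∀ τ₀ ∈ Icc τ₁ τ₂, ∀ s₀ ∈ Icc (0 : ℝ) 1, ∀ x ∈ D,
    (S.φ ((h τ₀ x).curve s₀) = 0 →
      ∃ ε > 0, StrictMonoOn (fun τ => S.φ ((h τ x).curve s₀))
        (Icc τ₁ τ₂ ∩ Ioo (τ₀ - ε) (τ₀ + ε))) ∧
    (∀ δ ∈ Ioc 0 S.δ₀, ∀ α β, S.IsDeltaInterval δ (h τ₀ x) α β → s₀ ∈ Icc α β →
      S.φ ((h τ₀ x).curve s₀) = -δ →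
      ∃ ε > 0, StrictMonoOn (fun τ => S.φ ((h τ x).curve s₀))
        (Icc τ₁ τ₂ ∩ Ioo (τ₀ - ε) (τ₀ + ε)))

/-- `h` is of type B on `[τ₁, τ₂]`: a continuous reparameterization by strictly increasing `H¹`
maps of `[0,1]` onto itself. -/
def TypeB (D : Set (H1Path (EuclideanSpace ℝ (Fin N))))
    (h : ℝ → H1Path (EuclideanSpace ℝ (Fin N)) → H1Path (EuclideanSpace ℝ (Fin N)))
    (τ₁ τ₂ : ℝ) : Prop :=
  ∃ L : ℝ → H1Path (EuclideanSpace ℝ (Fin N)) → H1Path ℝ,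
    ContinuousOn (fun p : ℝ × H1Path (EuclideanSpace ℝ (Fin N)) => L p.1 p.2)
      (Icc τ₁ τ₂ ×ˢ D) ∧
    ∀ x ∈ D,
      (∀ s ∈ Icc (0 : ℝ) 1, (L τ₁ x).curve s = s) ∧
      ∀ τ ∈ Icc τ₁ τ₂, (L τ x).curve 0 = 0 ∧ (L τ x).curve 1 = 1 ∧
        StrictMonoOn (L τ x).curve (Icc 0 1) ∧
        ∀ s ∈ Icc (0 : ℝ) 1, (h τ x).curve s = (h τ₁ x).curve ((L τ x).curve s)

/-- `h` is of type C on `[τ₁, τ₂]`. -/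
def TypeC (D : Set (H1Path (EuclideanSpace ℝ (Fin N))))
    (h : ℝ → H1Path (EuclideanSpace ℝ (Fin N)) → H1Path (EuclideanSpace ℝ (Fin N)))
    (τ₁ τ₂ : ℝ) : Prop :=
  ∀ x ∈ D, ∀ s ∈ Icc (0 : ℝ) 1, ∀ τ ∈ Icc τ₁ τ₂,
    ((h τ₁ x).curve s ∉ S.closedOmega → (h τ x).curve s = (h τ₁ x).curve s) ∧
    ((h τ₁ x).curve s ∈ S.Omega → (h τ x).curve s ∈ S.Omega)

namespace ChordMap

variable {S} (G : S.ChordMap)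

/-- The class `ℋ` of admissible homotopies `h : [0,1] × D → 𝔐`. -/
structure IsAdmissible (D : Set (H1Path (EuclideanSpace ℝ (Fin N))))
    (h : ℝ → H1Path (EuclideanSpace ℝ (Fin N)) → H1Path (EuclideanSpace ℝ (Fin N))) :
    Prop where
  dom : D ∈ G.closedInvariant
  continuousOn : ContinuousOn (fun p : ℝ × H1Path (EuclideanSpace ℝ (Fin N)) => h p.1 p.2)
    (Icc (0 : ℝ) 1 ×ˢ D)
  mem_paths : ∀ τ ∈ Icc (0 : ℝ) 1, ∀ x ∈ D, h τ x ∈ G.paths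
  start : ∀ x ∈ D, h 0 x = x
  const : ∀ τ ∈ Icc (0 : ℝ) 1, ∀ x ∈ G.constChords ∩ D, (h τ x).IsConst
  equivariant : ∀ τ ∈ Icc (0 : ℝ) 1, ∀ x ∈ D, h τ x.reverse = (h τ x).reverse
  partition : ∃ (k : ℕ) (t : ℕ → ℝ), t 0 = 0 ∧ t k = 1 ∧ ∀ i < k, t i < t (i + 1) ∧
    (S.TypeA D h (t i) (t (i + 1)) ∨ TypeB D h (t i) (t (i + 1)) ∨
      S.TypeC D h (t i) (t (i + 1)))

/-- The class `ℋ₁`: admissible homotopies for which, in addition, `φ ≤ -σ₁/2` along every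
topologically not essential interval of every curve `h(τ,x)`. -/
structure IsAdmissible₁ (δb γb σ₁ : ℝ) (D : Set (H1Path (EuclideanSpace ℝ (Fin N))))
    (h : ℝ → H1Path (EuclideanSpace ℝ (Fin N)) → H1Path (EuclideanSpace ℝ (Fin N))) : Prop
    extends G.IsAdmissible D h where
  not_essential : ∀ τ ∈ Icc (0 : ℝ) 1, ∀ x ∈ D, ∀ a b, S.IsMaxInner (h τ x) a b →
    ∀ α β, a ≤ α → β ≤ b → S.IsNotEssential δb γb σ₁ (h τ x) α β →
      ∀ s ∈ Icc α β, S.φ ((h τ x).curve s) ≤ -σ₁ / 2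

/-- The functional `ℱ(D,h)`, the supremum of the numbers `(b-a)/2 ∫_a^b g(ẏ,ẏ) ds` over
`y = h(1,x)`, `x ∈ D`, `[a,b] ∈ ℐ_y`; it takes values in `[0,∞]`, with `sup ∅ = 0`. -/
def Func (S : ConcaveDisk N) (D : Set (H1Path (EuclideanSpace ℝ (Fin N))))
    (h : ℝ → H1Path (EuclideanSpace ℝ (Fin N)) → H1Path (EuclideanSpace ℝ (Fin N))) : ℝ≥0∞ :=
  ⨆ (x ∈ D) (a : ℝ) (b : ℝ) (_ : S.IsMaxInner (h 1 x) a b),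
    ENNReal.ofReal ((b - a) / 2 * S.energy (h 1 x) a b)

/-- The minimax levels `c_i`, with values in `[0,∞]`. -/
def level (δb γb σ₁ : ℝ) (i : ℕ) : ℝ≥0∞ :=
  ⨅ (D : Set (H1Path (EuclideanSpace ℝ (Fin N))))
    (h : ℝ → H1Path (EuclideanSpace ℝ (Fin N)) → H1Path (EuclideanSpace ℝ (Fin N)))
    (_ : D ∈ G.Gam i) (_ : G.IsAdmissible₁ δb γb σ₁ D h), Func S D h

end ChordMap

end ConcaveDisk

end OrthogonalChords

end

noncomputable section

namespace OrthogonalChords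

open Filter Metric

/-! ### A retraction onto a regular level set -/

/-! The lower bound says that a family of curves with small energy inside `Ω̄` is topologically
trivial. Suppose `Func S D h` is below the bound, and let `y = h 1 x`. If `φ(y(s)) < 0`, then `s`
lies in a maximal inner interval `[a,b]`, and `φ(y(a)) = 0`. Cauchy-Schwarz and `‖∇φ‖ ≤ K₀` give
`φ(y(s))² ≤ (b-a) K₀² ∫_a^b g(ẏ,ẏ) < (3δ₀/4)²`. Hence `y` stays in the collar `{|φ| < δ₀}`
(`abs_φ_lt_of_energy_lt`), which has no critical points and retracts onto `∂Ω`
(`exists_retraction_zeroSet`).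

Identify a chord with its pair of end points `(A,B)`, so that `ℛ` becomes the swap. Move `A` along
the initial point of `h τ x`, then along `h 1 x` up to its midpoint, and retract this track to `∂Ω`.
By equivariance, `B` follows the track defined by `ℛx` and reaches the same midpoint. This deforms
the quotient of `D` into the constant chords (`relCoverable_zero`). Tietze extension, followed by
the retraction, extends the deformation to an open neighbourhood, so the relative category is `0`
and `D ∉ Γ₁`.

Monotonicity of the levels holds because the classes `Γ_i` decrease. -/

/-- A `C¹` function is uniformly differentiable on compact sets. -/
lemma exists_uniform_taylor {E : Type*} [NormedAddCommGroup E] [NormedSpace ℝ E] [ProperSpace E]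
    {U K : Set E} (hU : IsOpen U) (hK : IsCompact K) (hKU : K ⊆ U) {f : E → ℝ}
    (hf : ContDiffOn ℝ 1 f U) {ε : ℝ} (hε : 0 < ε) :
    ∃ ρ > 0, ∀ x ∈ K, ∀ v : E, ‖v‖ ≤ ρ →
      x + v ∈ U ∧ |f (x + v) - f x - fderiv ℝ f x v| ≤ ε * ‖v‖ := by
  obtain ⟨r, hr, hrU⟩ := hK.exists_cthickening_subset_open hU hKU
  have hc : IsCompact (cthickening r K) := hK.cthickening
  have hd : ContinuousOn (fderiv ℝ f) (cthickening r K) :=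
    (hf.continuousOn_fderiv_of_isOpen hU le_rfl).mono hrU
  have huc := hc.uniformContinuousOn_of_continuous hd
  rw [Metric.uniformContinuousOn_iff] at huc
  obtain ⟨ρ, hρ, hρ'⟩ := huc ε hε
  refine ⟨min r (ρ / 2), lt_min hr (half_pos hρ), fun x hx v hv => ?_⟩
  have hsub : closedBall x (min r (ρ / 2)) ⊆ cthickening r K :=
    (closedBall_subset_closedBall (min_le_left _ _)).trans (closedBall_subset_cthickening hx r)
  have hxm : x ∈ closedBall x (min r (ρ / 2)) :=
    mem_closedBall_self (le_min hr.le (half_pos hρ).le)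
  have hvm : x + v ∈ closedBall x (min r (ρ / 2)) := by
    simpa [mem_closedBall, dist_eq_norm] using hv
  refine ⟨hrU (hsub hvm), ?_⟩
  -- Mean value inequality on a convex ball, comparing `f` with its linear part at the centre;
  -- uniform continuity of the derivative on the compact thickening makes the radius independent of
  -- `x`.
  have key := (convex_closedBall x (min r (ρ / 2))).norm_image_sub_le_of_norm_fderiv_le'
    (𝕜 := ℝ) (f := f) (φ := fderiv ℝ f x) (C := ε)
    (fun y hy => ((hf.differentiableOn one_ne_zero) y (hrU (hsub hy))).differentiableAt
      (hU.mem_nhds (hrU (hsub hy)))) (fun y hy => ?_) hxm hvm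
  · simpa [Real.norm_eq_abs] using key
  · rw [← dist_eq_norm]
    refine (hρ' y (hsub hy) x (hsub hxm) ?_).le
    have h1 : dist y x ≤ min r (ρ / 2) := hy
    have h2 := min_le_right r (ρ / 2)
    linarith

/-- If iterating `T` on `K` makes `f` decay geometrically and the steps are controlled by `f`,
then the iterates converge to a retraction of `K` onto the zero set of `f`. -/
lemma exists_retraction_of_contracting {E : Type*} [NormedAddCommGroup E] [CompleteSpace E]
    {K : Set E} (hK : IsClosed K) {f : E → ℝ} (hf : ContinuousOn f K) {T : E → E}
    (hT : ContinuousOn T K) (hTK : MapsTo T K K) {q C δ : ℝ} (hq0 : 0 ≤ q) (hq : q < 1)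
    (hC : 0 ≤ C) (hδ : ∀ x ∈ K, |f x| ≤ δ)
    (hdec : ∀ x ∈ K, |f (T x)| ≤ q * |f x|) (hstep : ∀ x ∈ K, ‖T x - x‖ ≤ C * |f x|) :
    ∃ r : E → E, ContinuousOn r K ∧ (∀ x ∈ K, r x ∈ K ∧ f (r x) = 0) ∧
      ∀ x ∈ K, f x = 0 → r x = x := by
  have hmem : ∀ n, ∀ x ∈ K, T^[n] x ∈ K := fun n x hx => hTK.iterate n hx
  have hval : ∀ n, ∀ x ∈ K, |f (T^[n] x)| ≤ q ^ n * |f x| := by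
    intro n x hx
    induction n with
    | zero => simp
    | succ n ih =>
      rw [Function.iterate_succ_apply', pow_succ', mul_assoc]
      exact (hdec _ (hmem n x hx)).trans (mul_le_mul_of_nonneg_left ih hq0)
  have hdist : ∀ x ∈ K, ∀ n, dist (T^[n] x) (T^[n + 1] x) ≤ C * δ * q ^ n := by
    intro x hx n
    rw [Function.iterate_succ_apply', dist_comm, dist_eq_norm]
    refine (hstep _ (hmem n x hx)).trans ?_
    have h1 : q ^ n * |f x| ≤ q ^ n * δ := mul_le_mul_of_nonneg_left (hδ x hx) (pow_nonneg hq0 n)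
    calc C * |f (T^[n] x)| ≤ C * (q ^ n * δ) :=
          mul_le_mul_of_nonneg_left ((hval n x hx).trans h1) hC
      _ = C * δ * q ^ n := by ring
  have hlim : ∀ x ∈ K, ∃ y, Tendsto (fun n => T^[n] x) atTop (𝓝 y) := fun x hx =>
    cauchySeq_tendsto_of_complete (_root_.cauchySeq_of_le_geometric q (C * δ) hq (hdist x hx))
  choose! r hr using hlim
  refine ⟨r, ?_, fun x hx => ?_, fun x hx h0 => ?_⟩
  -- The geometric tail `C δ qⁿ / (1 - q)` does not depend on `x`, so the convergence is uniform and
  -- the limit continuous.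
  · have hu : TendstoUniformlyOn (fun n x => T^[n] x) r atTop K := by
      rw [Metric.tendstoUniformlyOn_iff]
      intro ε hε
      have h0 : Tendsto (fun n : ℕ => C * δ * q ^ n / (1 - q)) atTop (𝓝 0) := by
        have := ((tendsto_pow_atTop_nhds_zero_of_lt_one hq0 hq).const_mul (C * δ)).div_const (1 - q)
        simpa using this
      filter_upwards [h0.eventually (gt_mem_nhds hε)] with n hn x hx
      rw [dist_comm]
      exact (dist_le_of_le_geometric_of_tendsto q (C * δ) hq (hdist x hx) (hr x hx) n).trans_lt hn
    refine hu.continuousOn (Frequently.of_forall fun n => ?_)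
    exact hT.iterate hTK n
  · have hrK : r x ∈ K := hK.mem_of_tendsto (hr x hx) (Eventually.of_forall fun n => hmem n x hx)
    refine ⟨hrK, ?_⟩
    have h1 : Tendsto (fun n => f (T^[n] x)) atTop (𝓝 (f (r x))) :=
      (hf (r x) hrK).tendsto.comp (tendsto_nhdsWithin_iff.2
        ⟨hr x hx, Eventually.of_forall fun n => hmem n x hx⟩)
    have h2 : Tendsto (fun n => f (T^[n] x)) atTop (𝓝 0) := by
      refine squeeze_zero_norm (fun n => hval n x hx) ?_
      simpa using (tendsto_pow_atTop_nhds_zero_of_lt_one hq0 hq).mul_const |f x|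
    exact tendsto_nhds_unique h1 h2
  · have hfix : T x = x := by
      have := hstep x hx
      rw [h0, abs_zero, mul_zero] at this
      exact sub_eq_zero.1 (norm_le_zero_iff.1 this)
    refine tendsto_nhds_unique (hr x hx) ?_
    simp [Function.iterate_fixed hfix]

/-- The zero set of a `C¹` function is a retract of a compact region `{|f| ≤ δ}` free of critical
points. -/
lemma exists_retraction_zeroSet {E : Type*} [NormedAddCommGroup E] [InnerProductSpace ℝ E]
    [ProperSpace E] {U : Set E} (hU : IsOpen U) {f : E → ℝ}
    (hf : ContDiffOn ℝ 1 f U) {δ : ℝ} (hδ : 0 < δ) (hK : IsCompact {p | p ∈ U ∧ |f p| ≤ δ})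
    (hne : ∀ p ∈ U, |f p| ≤ δ → fderiv ℝ f p ≠ 0) :
    ∃ r : E → E, ContinuousOn r {p | p ∈ U ∧ |f p| ≤ δ} ∧
      (∀ p ∈ U, |f p| ≤ δ → r p ∈ U ∧ f (r p) = 0) ∧ ∀ p ∈ U, f p = 0 → r p = p := by
  set K := {p | p ∈ U ∧ |f p| ≤ δ} with hKdef
  have hKU : K ⊆ U := fun p hp => hp.1
  let n : E → E := fun x => (InnerProductSpace.toDual ℝ E).symm (fderiv ℝ f x)
  have hn : ContinuousOn n K :=
    (InnerProductSpace.toDual ℝ E).symm.continuous.comp_continuousOn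
      ((hf.continuousOn_fderiv_of_isOpen hU le_rfl).mono hKU)
  have hnn : ∀ x, fderiv ℝ f x (n x) = ‖n x‖ ^ 2 := by
    intro x
    rw [← real_inner_self_eq_norm_sq]
    exact (InnerProductSpace.toDual_symm_apply (𝕜 := ℝ)).symm
  obtain ⟨m, hm, hmle⟩ := hK.exists_forall_le' hn.norm (a := 0) (fun x hx => by
    rw [norm_pos_iff]
    simpa [n] using hne x hx.1 hx.2)
  obtain ⟨M, hM⟩ := hK.exists_bound_of_continuousOn hn
  -- With tolerance `m/2` and `m ≤ ‖n‖`, the Taylor error costs at most half of the first order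
  -- decrease of `|f|`.
  obtain ⟨ρ, hρ, htay⟩ := exists_uniform_taylor hU hK hKU hf (half_pos hm)
  obtain ⟨B, hB0, hMB⟩ : ∃ B > 0, M ≤ B := ⟨max M 1, by positivity, le_max_left _ _⟩
  -- The first condition keeps the step within the Taylor radius; the second prevents overshooting
  -- zero at first order.
  obtain ⟨κ, hκ, hκ1, hκ2⟩ : ∃ κ > 0, κ * (δ * B) ≤ ρ ∧ κ * B ^ 2 ≤ 1 := by
    refine ⟨min (ρ / (δ * B)) (1 / B ^ 2), by positivity, ?_, ?_⟩
    · rw [← le_div_iff₀ (by positivity)]; exact min_le_left _ _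
    · rw [← le_div_iff₀ (by positivity)]; exact min_le_right _ _
  -- A gradient descent step for `f²/2`, with `n` the Euclidean gradient of `f`: to first order `f
  -- (T x) = f x * (1 - κ ‖n x‖²)`.
  let T : E → E := fun x => x - (κ * f x) • n x
  have hstep : ∀ x ∈ K, ‖T x - x‖ ≤ κ * B * |f x| := by
    intro x hx
    have : T x - x = -((κ * f x) • n x) := by simp [T]
    rw [this, norm_neg, norm_smul, Real.norm_eq_abs, abs_mul, abs_of_pos hκ]
    have h1 := (hM x hx).trans hMB
    have h2 := mul_le_mul_of_nonneg_left h1 (mul_nonneg hκ.le (abs_nonneg (f x)))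
    linarith
  have hdecU : ∀ x ∈ K, T x ∈ U ∧ |f (T x)| ≤ (1 - κ * m ^ 2 / 2) * |f x| := by
    intro x hx
    have hv : ‖-((κ * f x) • n x)‖ ≤ ρ := by
      have h1 := hstep x hx
      have h2 : κ * B * |f x| ≤ κ * B * δ := mul_le_mul_of_nonneg_left hx.2 (by positivity)
      have : T x - x = -((κ * f x) • n x) := by simp [T]
      rw [this] at h1
      linarith
    obtain ⟨h1, h2⟩ := htay x hx _ hv
    have hTx : x + -((κ * f x) • n x) = T x := by simp [T, sub_eq_add_neg]
    rw [hTx] at h1 h2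
    refine ⟨h1, ?_⟩
    have hnm := hmle x hx
    have hnB := (hM x hx).trans hMB
    rw [norm_neg, map_neg, map_smul, hnn, norm_smul, Real.norm_eq_abs, abs_mul, abs_of_pos hκ,
      smul_eq_mul] at h2
    set t := ‖n x‖
    have ht2 : κ * t ^ 2 ≤ 1 := by
      refine le_trans ?_ hκ2
      gcongr
    have e1 : f (T x) = f x * (1 - κ * t ^ 2) + (f (T x) - f x - -(κ * f x * t ^ 2)) := by ring
    have e2 : |f x * (1 - κ * t ^ 2)| = |f x| * (1 - κ * t ^ 2) := by
      rw [abs_mul, abs_of_nonneg (by linarith : 0 ≤ 1 - κ * t ^ 2)]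
    have e3 : |f (T x)| ≤ |f x| * (1 - κ * t ^ 2) + m / 2 * (κ * |f x| * t) := by
      rw [e1]
      refine (abs_add_le _ _).trans ?_
      rw [e2]
      gcongr
    have e4 : m * t ≤ t ^ 2 := by nlinarith
    have e5 : m ^ 2 ≤ t ^ 2 := by gcongr
    have e6 : 0 ≤ κ * |f x| := by positivity
    nlinarith [mul_le_mul_of_nonneg_left e4 e6, mul_le_mul_of_nonneg_left e5 e6]
  -- When `K` is empty, nothing relates `m` to `B`, and the contraction factor might be negative.
  have hq0 : 0 ≤ 1 - κ * m ^ 2 / 2 ∨ K = ∅ := by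
    rcases K.eq_empty_or_nonempty with h | ⟨x, hx⟩
    · exact Or.inr h
    · left
      have : κ * m ^ 2 ≤ κ * B ^ 2 := by
        gcongr
        exact (hmle x hx).trans ((hM x hx).trans hMB)
      linarith
  rcases hq0 with hq0 | hempty
  · have hq1 : 1 - κ * m ^ 2 / 2 < 1 := by have : 0 < κ * m ^ 2 := by positivity
                                           linarith
    obtain ⟨r, h1, h2, h3⟩ := exists_retraction_of_contracting hK.isClosed (f := f) (T := T)
      (hf.continuousOn.mono hKU)
      (continuousOn_id.sub ((continuousOn_const.mul (hf.continuousOn.mono hKU)).smul hn))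
      (fun x hx => ⟨(hdecU x hx).1, by
        refine (hdecU x hx).2.trans (le_trans ?_ hx.2)
        nlinarith [abs_nonneg (f x)]⟩)
      hq0 hq1 (C := κ * B) (by positivity) (fun x hx => hx.2) (fun x hx => (hdecU x hx).2) hstep
    refine ⟨r, h1, fun p hp hp' => ⟨(h2 p ⟨hp, hp'⟩).1.1, (h2 p ⟨hp, hp'⟩).2⟩, fun p hp h0 => ?_⟩
    exact h3 p ⟨hp, by rw [h0, abs_zero]; exact hδ.le⟩ h0
  · have hno : ∀ p ∈ U, ¬ |f p| ≤ δ := fun p hp hp' => by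
      have : p ∈ K := ⟨hp, hp'⟩
      simp [hempty] at this
    refine ⟨id, continuousOn_id, fun p hp hp' => (hno p hp hp').elim, fun p hp _ => rfl⟩

/-! ### Evaluation of Sobolev curves -/

namespace H1Path

variable {V : Type*} [NormedAddCommGroup V] [NormedSpace ℝ V]

lemma integrable_vel (x : H1Path V) : Integrable (fun t => x.2 t) unitMeasure :=
  (Lp.memLp x.2).integrable (by norm_num)

lemma curve_sub_curve (x : H1Path V) {s t : ℝ} (hs : s ∈ Icc (0 : ℝ) 1) (ht : t ∈ Icc (0 : ℝ) 1) :
    x.curve t - x.curve s = ∫ u in s..t, x.2 u := by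
  simp only [curve]
  rw [← intervalIntegral.integral_add_adjacent_intervals
    (x.intervalIntegrable_vel (by simp) hs) (x.intervalIntegrable_vel hs ht)]
  abel

/-- Arc length serves as a real-valued majorant for the oscillation of the curve, through which
absolute continuity is transferred below. -/
lemma dist_curve_le (x : H1Path V) {s t : ℝ} (hs : s ∈ Icc (0 : ℝ) 1) (ht : t ∈ Icc (0 : ℝ) 1) :
    dist (x.curve s) (x.curve t) ≤
      dist (∫ u in (0 : ℝ)..s, ‖x.2 u‖) (∫ u in (0 : ℝ)..t, ‖x.2 u‖) := by
  rw [dist_comm, dist_comm (∫ u in (0 : ℝ)..s, ‖x.2 u‖), dist_eq_norm, x.curve_sub_curve hs ht,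
    Real.dist_eq, intervalIntegral.integral_interval_sub_left
      (x.intervalIntegrable_vel (by simp) ht).norm (x.intervalIntegrable_vel (by simp) hs).norm]
  exact intervalIntegral.norm_integral_le_abs_integral_norm

lemma continuousOn_curve (x : H1Path V) : ContinuousOn x.curve (Icc 0 1) := by
  refine continuousOn_const.add ?_
  have := intervalIntegral.continuousOn_primitive_interval (a := (0 : ℝ)) (b := 1)
    (f := fun t => x.2 t) (μ := volume) (by rw [uIcc_of_le zero_le_one]; exact x.integrable_vel)
  rwa [uIcc_of_le zero_le_one] at this

/-- The embedding of `H¹` into the continuous curves is Lipschitz. -/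
lemma dist_curve_curve_le (x y : H1Path V) {s : ℝ} (hs : s ∈ Icc (0 : ℝ) 1) :
    dist (x.curve s) (y.curve s) ≤ 2 * dist x y := by
  have h0 : x.curve s - y.curve s = (x.1 - y.1) + ∫ u in (0 : ℝ)..s, (x.2 - y.2 : Lp V 2 _) u := by
    have h1 : ∫ u in (0 : ℝ)..s, (x.2 - y.2 : Lp V 2 _) u = ∫ u in (0 : ℝ)..s, (x.2 u - y.2 u) := by
      apply intervalIntegral.integral_congr_ae
      filter_upwards [(ae_restrict_iff' measurableSet_Icc).1 (Lp.coeFn_sub x.2 y.2)] with t ht htm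
      rw [uIoc_of_le hs.1] at htm
      simpa using ht ⟨htm.1.le, htm.2.trans hs.2⟩
    rw [h1, intervalIntegral.integral_sub (x.intervalIntegrable_vel (by simp) hs)
      (y.intervalIntegrable_vel (by simp) hs)]
    simp only [curve]
    abel
  have h2 : ‖∫ u in (0 : ℝ)..s, (x.2 - y.2 : Lp V 2 _) u‖ ≤ ‖x.2 - y.2‖ := by
    rw [intervalIntegral.integral_of_le hs.1]
    set z : Lp V 2 unitMeasure := x.2 - y.2
    have hz : Integrable (fun t => z t) unitMeasure := (Lp.memLp z).integrable (by norm_num)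
    -- On a probability space the `L¹` norm is at most the `L²` norm. The factor `2` then counts the
    -- starting point and the derivative.
    have hpm : unitMeasure univ = 1 := by simp [unitMeasure]
    have : IsProbabilityMeasure unitMeasure := ⟨hpm⟩
    calc ‖∫ u in Ioc 0 s, z u‖ ≤ ∫ u in Ioc 0 s, ‖z u‖ := norm_integral_le_integral_norm _
      _ ≤ ∫ u, ‖z u‖ ∂unitMeasure := by
        refine setIntegral_mono_set hz.norm (ae_of_all _ fun _ => norm_nonneg _) ?_
        exact (Ioc_subset_Icc_self.trans (Icc_subset_Icc_right hs.2)).eventuallyLE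
      _ = (eLpNorm z 1 unitMeasure).toReal := by
        rw [integral_norm_eq_lintegral_enorm hz.1, eLpNorm_one_eq_lintegral_enorm]
      _ ≤ (eLpNorm z 2 unitMeasure).toReal :=
        ENNReal.toReal_mono (Lp.eLpNorm_ne_top z)
          (eLpNorm_le_eLpNorm_of_exponent_le (by norm_num) (Lp.aestronglyMeasurable z))
      _ = ‖z‖ := (Lp.norm_def z).symm
  rw [dist_eq_norm, h0]
  have h3 : ‖x.1 - y.1‖ ≤ dist x y := by
    rw [← dist_eq_norm, Prod.dist_eq]; exact le_max_left _ _
  have h4 : ‖x.2 - y.2‖ ≤ dist x y := by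
    rw [← dist_eq_norm, Prod.dist_eq]; exact le_max_right _ _
  linarith [norm_add_le (x.1 - y.1) (∫ u in (0 : ℝ)..s, (x.2 - y.2 : Lp V 2 _) u)]

/-- Joint continuity: the Lipschitz bound in the curve is uniform in the time, and each single curve
is continuous. -/
lemma continuousOn_eval :
    ContinuousOn (fun p : H1Path V × ℝ => p.1.curve p.2) (univ ×ˢ Icc 0 1) := by
  rintro ⟨x, s⟩ ⟨-, hs⟩
  have h1 : Tendsto (fun p : H1Path V × ℝ => 2 * dist p.1 x + dist (x.curve p.2) (x.curve s))
      (𝓝[univ ×ˢ Icc 0 1] (x, s)) (𝓝 (2 * 0 + 0)) := by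
    refine Tendsto.add (Tendsto.const_mul _ ?_) ?_
    · refine tendsto_iff_dist_tendsto_zero.1 ?_
      exact continuous_fst.continuousAt.continuousWithinAt
    · refine tendsto_iff_dist_tendsto_zero.1 ?_
      have h := (x.continuousOn_curve s hs).tendsto
      refine h.comp (tendsto_nhdsWithin_iff.2
        ⟨continuous_snd.continuousAt.continuousWithinAt, ?_⟩)
      exact eventually_mem_nhdsWithin.mono fun p hp => hp.2
  rw [mul_zero, add_zero] at h1
  refine tendsto_iff_dist_tendsto_zero.2 (squeeze_zero' (Eventually.of_forall fun _ => dist_nonneg)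
    ?_ h1)
  filter_upwards [eventually_mem_nhdsWithin] with p hp
  refine (dist_triangle _ (x.curve p.2) _).trans ?_
  gcongr
  exact dist_curve_curve_le _ _ hp.2

end H1Path

/-! ### The chain rule along Sobolev curves -/

namespace H1Path

variable {V : Type*} [NormedAddCommGroup V] [NormedSpace ℝ V]

/-- A `C¹` function is absolutely continuous along an `H¹` curve. -/
lemma absolutelyContinuousOnInterval_comp_curve (x : H1Path V) {U : Set V} (hU : IsOpen U)
    {f : V → ℝ} (hf : ContDiffOn ℝ 1 f U) {a b : ℝ} (ha : 0 ≤ a) (hab : a ≤ b) (hb : b ≤ 1)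
    (hx : ∀ s ∈ Icc a b, x.curve s ∈ U) :
    AbsolutelyContinuousOnInterval (fun s => f (x.curve s)) a b := by
  have hsub : Icc a b ⊆ Icc (0 : ℝ) 1 := Icc_subset_Icc ha hb
  have hcomp : IsCompact (x.curve '' Icc a b) :=
    isCompact_Icc.image_of_continuousOn (x.continuousOn_curve.mono hsub)
  -- A local Lipschitz bound on the compact trace becomes global there without any convexity, so the
  -- variation sums of `f ∘ x` are at most `L` times those of arc length.
  have hlip : LocallyLipschitzOn (x.curve '' Icc a b) f := by
    rintro p ⟨s, hs, rfl⟩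
    obtain ⟨L, t, ht, hL⟩ :=
      (hf.contDiffAt (hU.mem_nhds (hx s hs))).exists_lipschitzOnWith
    exact ⟨L, t, mem_nhdsWithin_of_mem_nhds ht, hL⟩
  obtain ⟨L, hL⟩ := hlip.exists_lipschitzOnWith_of_compact hcomp
  have hN : AbsolutelyContinuousOnInterval (fun t => ∫ u in (0 : ℝ)..t, ‖x.2 u‖) a b := by
    have h1 : IntervalIntegrable (fun u => ‖x.2 u‖) volume 0 1 :=
      (x.intervalIntegrable_vel (by simp) (by simp)).norm
    refine (h1.absolutelyContinuousOnInterval_intervalIntegral (c := 0) (by simp)).mono ?_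
    rwa [uIcc_of_le hab, uIcc_of_le zero_le_one]
  have hN' := hN.const_mul (L : ℝ)
  unfold AbsolutelyContinuousOnInterval at hN' ⊢
  refine squeeze_zero' (Eventually.of_forall fun _ => Finset.sum_nonneg fun _ _ => dist_nonneg)
    ?_ hN'
  rw [eventually_inf_principal]
  filter_upwards with E hE
  refine Finset.sum_le_sum fun i hi => ?_
  obtain ⟨h1, h2⟩ := hE.1 i hi
  rw [uIcc_of_le hab] at h1 h2
  refine (hL.dist_le_mul _ (mem_image_of_mem _ h1) _ (mem_image_of_mem _ h2)).trans ?_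
  rw [Real.dist_eq ((L : ℝ) * _), ← mul_sub, abs_mul, NNReal.abs_eq, ← Real.dist_eq]
  exact mul_le_mul_of_nonneg_left (x.dist_curve_le (hsub h1) (hsub h2)) L.2

/-- The fundamental theorem of calculus for a `C¹` function along an `H¹` curve. -/
lemma integral_fderiv_vel [CompleteSpace V] (x : H1Path V) {U : Set V} (hU : IsOpen U)
    {f : V → ℝ} (hf : ContDiffOn ℝ 1 f U) {a b : ℝ} (ha : 0 ≤ a) (hab : a ≤ b) (hb : b ≤ 1)
    (hx : ∀ s ∈ Icc a b, x.curve s ∈ U) :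
    ∫ t in a..b, fderiv ℝ f (x.curve t) (x.vel t) = f (x.curve b) - f (x.curve a) := by
  rw [← (x.absolutelyContinuousOnInterval_comp_curve hU hf ha hab hb hx).integral_deriv_eq_sub]
  apply intervalIntegral.integral_congr_ae
  have h1 : IntervalIntegrable (fun t => x.2 t) volume 0 1 :=
    x.intervalIntegrable_vel (by simp) (by simp)
  filter_upwards [h1.ae_hasDerivAt_integral] with t ht htm
  rw [uIoc_of_le hab] at htm
  have hmem : t ∈ uIcc (0 : ℝ) 1 := by
    rw [uIcc_of_le zero_le_one]; exact ⟨ha.trans htm.1.le, htm.2.trans hb⟩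
  have hd : HasDerivAt x.curve (x.vel t) t := (ht hmem 0 (by simp)).const_add x.1
  have hfd : HasFDerivAt f (fderiv ℝ f (x.curve t)) (x.curve t) :=
    ((hf.contDiffAt (hU.mem_nhds (hx t ⟨htm.1.le, htm.2⟩))).differentiableAt one_ne_zero).hasFDerivAt
  exact (hfd.comp_hasDerivAt t hd).deriv.symm

end H1Path

/-! ### One-variable tools: Cauchy-Schwarz and entrance times -/

/-- The Cauchy-Schwarz inequality for an integral over an interval. -/
lemma sq_intervalIntegral_le {u : ℝ → ℝ} {a b : ℝ} (hab : a ≤ b)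
    (hu : IntervalIntegrable u volume a b) (hu2 : IntervalIntegrable (fun t => u t ^ 2) volume a b) :
    (∫ t in a..b, u t) ^ 2 ≤ (b - a) * ∫ t in a..b, u t ^ 2 := by
  rcases hab.eq_or_lt with rfl | hlt
  · simp
  set m := ∫ t in a..b, u t
  -- The integral of this square is `b - a` times the defect in the claimed inequality.
  have h0 : 0 ≤ ∫ t in a..b, ((b - a) * u t - m) ^ 2 :=
    intervalIntegral.integral_nonneg hab fun _ _ => sq_nonneg _
  have h1 : ∫ t in a..b, ((b - a) * u t - m) ^ 2 =
      (b - a) ^ 2 * (∫ t in a..b, u t ^ 2) - (2 * (b - a) * m) * m + (b - a) * m ^ 2 := by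
    have e : (fun t => ((b - a) * u t - m) ^ 2) =
        fun t => (b - a) ^ 2 * u t ^ 2 - (2 * (b - a) * m) * u t + m ^ 2 := by
      ext t; ring
    rw [e, intervalIntegral.integral_add ((hu2.const_mul _).sub (hu.const_mul _))
      intervalIntegrable_const, intervalIntegral.integral_sub (hu2.const_mul _) (hu.const_mul _),
      intervalIntegral.integral_const_mul, intervalIntegral.integral_const_mul,
      intervalIntegral.integral_const, smul_eq_mul]
  rw [h1] at h0
  have hpos : 0 < b - a := sub_pos.2 hlt
  have h2 : 0 ≤ (b - a) * ((b - a) * (∫ t in a..b, u t ^ 2) - m ^ 2) := by linarith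
  linarith [nonneg_of_mul_nonneg_right h2 hpos]

/-- A continuous function that is nonnegative at `c` and negative at `s ≥ c` has a smallest zero
in `[c, s]` among those after which it stays nonpositive. -/
lemma exists_least_entrance {f : ℝ → ℝ} (hf : Continuous f) {c s : ℝ} (hcs : c ≤ s)
    (hc : 0 ≤ f c) (hs : f s < 0) :
    ∃ a ∈ Icc c s, f a = 0 ∧ (∀ u ∈ Icc a s, f u ≤ 0) ∧
      ∀ a' ∈ Icc c s, f a' = 0 → (∀ u ∈ Icc a' s, f u ≤ 0) → a ≤ a' := by
  -- The interval `[a,s]` moves with `a`; writing the condition through `max a u` makes it an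
  -- intersection of closed conditions on `a`.
  let A := {a | a ∈ Icc c s ∧ f a = 0 ∧ ∀ u ∈ Icc c s, f (max a u) ≤ 0}
  have hA : IsCompact A := by
    refine isCompact_Icc.inter_right (s := Icc c s) (t := {a | f a = 0 ∧ ∀ u ∈ Icc c s, f (max a u) ≤ 0}) ?_
    refine (isClosed_eq hf continuous_const).inter ?_
    have : {a | ∀ u ∈ Icc c s, f (max a u) ≤ 0} = ⋂ u ∈ Icc c s, {a | f (max a u) ≤ 0} := by
      ext; simp
    change IsClosed {a | ∀ u ∈ Icc c s, f (max a u) ≤ 0}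
    rw [this]
    exact isClosed_biInter fun u _ =>
      isClosed_le (hf.comp (continuous_id.max continuous_const)) continuous_const
  have hmemA : ∀ a ∈ Icc c s, f a = 0 → (∀ u ∈ Icc a s, f u ≤ 0) → a ∈ A :=
    fun a ha h0 h => ⟨ha, h0, fun u hu => h _ ⟨le_max_left _ _, max_le ha.2 hu.2⟩⟩
  have hne : A.Nonempty := by
    -- The last time at which `f ≥ 0` is an admissible zero.
    have hB : IsCompact (Icc c s ∩ {t | 0 ≤ f t}) :=
      isCompact_Icc.inter_right (isClosed_le continuous_const hf)
    obtain ⟨t, ⟨ht, ht0⟩, htmax⟩ := hB.exists_isGreatest ⟨c, ⟨le_rfl, hcs⟩, hc⟩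
    have hneg : ∀ u ∈ Ioc t s, f u < 0 := fun u hu => by
      by_contra! h
      exact absurd (htmax ⟨⟨ht.1.trans hu.1.le, hu.2⟩, h⟩) (not_le.2 hu.1)
    have hzero : f t = 0 := by
      obtain ⟨v, hv, hv0⟩ := intermediate_value_Icc' ht.2 hf.continuousOn
        (show (0 : ℝ) ∈ Icc (f s) (f t) from ⟨hs.le, ht0⟩)
      have := htmax ⟨⟨ht.1.trans hv.1, hv.2⟩, hv0.ge⟩
      rwa [le_antisymm this hv.1] at hv0
    refine ⟨t, hmemA t ht hzero fun u hu => ?_⟩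
    rcases hu.1.eq_or_lt with rfl | h
    · exact hzero.le
    · exact (hneg u ⟨h, hu.2⟩).le
  obtain ⟨a, ⟨ha, ha0, hau⟩, hmin⟩ := hA.exists_isLeast hne
  refine ⟨a, ha, ha0, fun u hu => ?_, fun a' ha' h0 h => hmin (hmemA a' ha' h0 h)⟩
  have := hau u ⟨ha.1.trans hu.1, hu.2⟩
  rwa [max_eq_right hu.1] at this

namespace ConcaveDisk

variable {N : ℕ} (S : ConcaveDisk N)

/-! ### The gradient and the constant `K₀` -/

lemma contDiffOn_φ_one : ContDiffOn ℝ 1 S.φ S.U := S.contDiffOn_φ.of_le (by norm_num)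

/-- A positive definite form is injective, hence bijective onto the dual by dimension. So `inverse`
in `riemGrad` is a true inverse and not its default value `0`. -/
lemma isInvertible_g {p : EuclideanSpace ℝ (Fin N)} (hp : p ∈ S.U) : (S.g p).IsInvertible := by
  have hinj : Function.Injective (S.g p).toLinearMap := by
    rw [← LinearMap.ker_eq_bot, LinearMap.ker_eq_bot']
    intro v hv
    by_contra hne
    have h1 := S.g_pos p hp v hne
    have h2 : S.g p v = 0 := hv
    rw [h2] at h1
    simp at h1
  let J := (InnerProductSpace.toDual ℝ (EuclideanSpace ℝ (Fin N))).toLinearEquiv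
  have hfin : Module.finrank ℝ (EuclideanSpace ℝ (Fin N)) =
      Module.finrank ℝ (EuclideanSpace ℝ (Fin N) →L[ℝ] ℝ) := J.finrank_eq
  let e := LinearEquiv.ofInjectiveOfFinrankEq (S.g p).toLinearMap hinj hfin
  exact ⟨e.toContinuousLinearEquiv, by ext v w; rfl⟩

lemma g_grad {p : EuclideanSpace ℝ (Fin N)} (hp : p ∈ S.U) : S.g p (S.grad p) = fderiv ℝ S.φ p := by
  obtain ⟨e, he⟩ := S.isInvertible_g hp
  rw [grad, riemGrad, ← he, ContinuousLinearMap.inverse_equiv]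
  exact e.apply_symm_apply _

lemma continuousOn_grad : ContinuousOn S.grad S.U := by
  have h1 : ContinuousOn (fun p => (S.g p).inverse) S.U := fun p hp =>
    ((S.isInvertible_g hp).contDiffAt_map_inverse (n := 0)).continuousAt.comp_continuousWithinAt
      (S.contDiffOn_g.continuousOn p hp)
  exact h1.clm_apply (S.contDiffOn_φ_one.continuousOn_fderiv_of_isOpen S.isOpen_U le_rfl)

lemma g_nonneg {p : EuclideanSpace ℝ (Fin N)} (hp : p ∈ S.U) (v : EuclideanSpace ℝ (Fin N)) :
    0 ≤ S.g p v v := by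
  rcases eq_or_ne v 0 with rfl | h
  · simp
  · exact (S.g_pos p hp v h).le

/-- Cauchy-Schwarz for `g`, from positivity at the vector `g(v,v) u - g(u,v) v`. -/
lemma sq_g_le {p : EuclideanSpace ℝ (Fin N)} (hp : p ∈ S.U) (u v : EuclideanSpace ℝ (Fin N)) :
    S.g p u v ^ 2 ≤ S.g p u u * S.g p v v := by
  rcases eq_or_ne v 0 with rfl | h
  · simp
  have hv := S.g_pos p hp v h
  have hw := S.g_nonneg hp (S.g p v v • u - S.g p u v • v)
  have e : S.g p (S.g p v v • u - S.g p u v • v) (S.g p v v • u - S.g p u v • v) =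
      S.g p v v * (S.g p u u * S.g p v v - S.g p u v ^ 2) := by
    simp only [map_sub, map_smul, sub_apply, smul_apply,
      smul_eq_mul, S.g_symm p hp v u]
    ring
  rw [e] at hw
  linarith [nonneg_of_mul_nonneg_right hw hv]

lemma sqrt_g_grad_le_K₀ {p : EuclideanSpace ℝ (Fin N)} (hp : p ∈ S.U) (hφ : S.φ p ≤ S.δ₀) :
    Real.sqrt (S.g p (S.grad p) (S.grad p)) ≤ S.K₀ := by
  refine le_csSup ?_ (mem_image_of_mem _ ⟨hp, hφ⟩)
  refine S.isCompact_sublevel.bddAbove_image (Real.continuous_sqrt.comp_continuousOn ?_)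
  have hsub : {p | p ∈ S.U ∧ S.φ p ≤ S.δ₀} ⊆ S.U := fun p hp => hp.1
  exact (((S.contDiffOn_g.continuousOn).clm_apply S.continuousOn_grad).clm_apply
    S.continuousOn_grad).mono hsub

lemma fderiv_ne_zero {p : EuclideanSpace ℝ (Fin N)} (hp : p ∈ S.U) (hφ : |S.φ p| ≤ S.δ₀) :
    fderiv ℝ S.φ p ≠ 0 := by
  intro h
  refine S.grad_ne_zero p hp ⟨(abs_le.1 hφ).1, (abs_le.1 hφ).2⟩ ?_
  rw [riemGrad, h, map_zero]

lemma isCompact_closedOmega : IsCompact S.closedOmega := by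
  obtain ⟨e⟩ := S.disk
  have : CompactSpace {p // p ∈ S.U ∧ S.φ p ≤ 0} := e.symm.compactSpace
  exact isCompact_iff_compactSpace.2 this

/-- Otherwise `Ω̄ = Ω` would be a nonempty compact open subset of the connected noncompact space
`ℝᴺ`. -/
lemma bdry_nonempty (hN : 2 ≤ N) : S.bdry.Nonempty := by
  by_contra hempty
  have heq : S.closedOmega = S.Omega := by
    ext p
    refine ⟨fun hp => ⟨hp.1, hp.2.lt_of_ne fun h => hempty ⟨p, hp.1, h⟩⟩, fun hp => ⟨hp.1, hp.2.le⟩⟩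
  have hopen : IsOpen S.closedOmega := by
    rw [heq]
    exact S.contDiffOn_φ.continuousOn.isOpen_inter_preimage S.isOpen_U isOpen_Iio
  have hclopen : IsClopen S.closedOmega := ⟨S.isCompact_closedOmega.isClosed, hopen⟩
  rcases isClopen_iff.1 hclopen with h | h
  · obtain ⟨e⟩ := S.disk
    have := (e.symm ⟨0, by simp⟩).2
    have h' : (e.symm ⟨0, by simp⟩ : EuclideanSpace ℝ (Fin N)) ∈ S.closedOmega := this
    rw [h] at h'
    exact h'
  · have : Nonempty (Fin N) := ⟨⟨0, by omega⟩⟩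
    exact noncompact_univ (EuclideanSpace ℝ (Fin N)) (h ▸ S.isCompact_closedOmega)

/-- The gradient does not vanish at a boundary point. Positivity makes `3δ₀/(4K₀)` a genuine
quotient. -/
lemma K₀_pos (hN : 2 ≤ N) : 0 < S.K₀ := by
  obtain ⟨p, hp, h0⟩ := S.bdry_nonempty hN
  have hδ := S.δ₀_pos
  refine lt_of_lt_of_le ?_ (S.sqrt_g_grad_le_K₀ hp (h0.le.trans hδ.le))
  refine Real.sqrt_pos.2 (S.g_pos p hp _ (S.grad_ne_zero p hp ?_))
  rw [h0]
  exact ⟨by linarith, hδ.le⟩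

/-! ### The energy estimate -/

/-- The metric is bounded along the compact trace, so a multiple of the integrable function `‖ẋ‖²`
dominates the integrand. -/
lemma intervalIntegrable_energy (x : H1Path (EuclideanSpace ℝ (Fin N))) {a b : ℝ} (ha : 0 ≤ a)
    (hab : a ≤ b) (hb : b ≤ 1) (hx : ∀ s ∈ Icc a b, x.curve s ∈ S.U) :
    IntervalIntegrable (fun t => S.g (x.curve t) (x.vel t) (x.vel t)) volume a b := by
  have hsub : Icc a b ⊆ Icc (0 : ℝ) 1 := Icc_subset_Icc ha hb
  have hg : ContinuousOn (fun t => S.g (x.curve t)) (Icc a b) :=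
    S.contDiffOn_g.continuousOn.comp (x.continuousOn_curve.mono hsub) hx
  obtain ⟨C, hC⟩ := isCompact_Icc.exists_bound_of_continuousOn
    (E := EuclideanSpace ℝ (Fin N) →L[ℝ] EuclideanSpace ℝ (Fin N) →L[ℝ] ℝ) hg
  have hv : MemLp (fun t => x.vel t) 2 (volume.restrict (Icc a b)) :=
    (Lp.memLp x.2).mono_measure (Measure.restrict_mono hsub le_rfl)
  have hv2 : Integrable (fun t => ‖x.vel t‖ ^ 2) (volume.restrict (Icc a b)) := hv.norm.integrable_sq
  have happ : ∀ F : Type, ∀ [NormedAddCommGroup F] [NormedSpace ℝ F],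
      Continuous fun p : (EuclideanSpace ℝ (Fin N) →L[ℝ] F) × EuclideanSpace ℝ (Fin N) => p.1 p.2 :=
    fun F _ _ => continuous_fst.clm_apply continuous_snd
  have hm : AEStronglyMeasurable (fun t => S.g (x.curve t) (x.vel t) (x.vel t))
      (volume.restrict (Icc a b)) :=
    (happ _).comp_aestronglyMeasurable
      (((happ _).comp_aestronglyMeasurable
        ((hg.aestronglyMeasurable measurableSet_Icc).prodMk hv.1)).prodMk hv.1)
  rw [intervalIntegrable_iff_integrableOn_Icc_of_le hab]
  refine (hv2.const_mul C).mono' hm ?_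
  filter_upwards [ae_restrict_mem measurableSet_Icc] with t ht
  calc ‖S.g (x.curve t) (x.vel t) (x.vel t)‖ ≤ ‖S.g (x.curve t)‖ * ‖x.vel t‖ * ‖x.vel t‖ :=
        ContinuousLinearMap.le_opNorm₂ _ _ _
    _ ≤ C * ‖x.vel t‖ * ‖x.vel t‖ := by
        have := hC t ht
        gcongr
    _ = C * ‖x.vel t‖ ^ 2 := by ring

/-- Along a curve in `{φ ≤ δ₀}` the variation of `φ` is controlled by the energy. -/
lemma sq_sub_le_energy (x : H1Path (EuclideanSpace ℝ (Fin N))) {a b : ℝ} (ha : 0 ≤ a)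
    (hab : a ≤ b) (hb : b ≤ 1) (hx : ∀ s ∈ Icc a b, x.curve s ∈ S.U ∧ S.φ (x.curve s) ≤ S.δ₀) :
    (S.φ (x.curve b) - S.φ (x.curve a)) ^ 2 ≤ (b - a) * (S.K₀ ^ 2 * S.energy x a b) := by
  have hsub : Icc a b ⊆ Icc (0 : ℝ) 1 := Icc_subset_Icc ha hb
  have hxU : ∀ s ∈ Icc a b, x.curve s ∈ S.U := fun s hs => (hx s hs).1
  have hE := S.intervalIntegrable_energy x ha hab hb hxU
  let u : ℝ → ℝ := fun t => fderiv ℝ S.φ (x.curve t) (x.vel t)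
  -- Since `dφ(ẋ) = g(∇φ, ẋ)`, Cauchy-Schwarz for `g` brings in `‖∇φ‖² ≤ K₀²`.
  have hu2 : ∀ t ∈ Icc a b, u t ^ 2 ≤ S.K₀ ^ 2 * S.g (x.curve t) (x.vel t) (x.vel t) := by
    intro t ht
    obtain ⟨h1, h2⟩ := hx t ht
    have h3 := S.sq_g_le h1 (S.grad (x.curve t)) (x.vel t)
    rw [S.g_grad h1] at h3
    refine h3.trans (mul_le_mul_of_nonneg_right ?_ (S.g_nonneg h1 _))
    rw [← S.g_grad h1]
    exact (Real.sqrt_le_left ((Real.sqrt_nonneg _).trans (S.sqrt_g_grad_le_K₀ h1 h2))).1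
      (S.sqrt_g_grad_le_K₀ h1 h2)
  have hmeas : AEStronglyMeasurable u (volume.restrict (Icc a b)) := by
    have h1 : ContinuousOn (fun t => fderiv ℝ S.φ (x.curve t)) (Icc a b) :=
      (S.contDiffOn_φ_one.continuousOn_fderiv_of_isOpen S.isOpen_U le_rfl).comp
        (x.continuousOn_curve.mono hsub) hxU
    have happ : Continuous fun p : (EuclideanSpace ℝ (Fin N) →L[ℝ] ℝ) ×
        EuclideanSpace ℝ (Fin N) => p.1 p.2 := continuous_fst.clm_apply continuous_snd
    exact happ.comp_aestronglyMeasurable ((h1.aestronglyMeasurable measurableSet_Icc).prodMk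
      ((Lp.aestronglyMeasurable x.2).mono_measure (Measure.restrict_mono hsub le_rfl)))
  have hi2 : IntervalIntegrable (fun t => u t ^ 2) volume a b := by
    rw [intervalIntegrable_iff_integrableOn_Icc_of_le hab] at hE ⊢
    refine (hE.const_mul (S.K₀ ^ 2)).mono' (hmeas.pow 2) ?_
    filter_upwards [ae_restrict_mem measurableSet_Icc] with t ht
    rw [Real.norm_eq_abs, abs_of_nonneg (sq_nonneg _)]
    exact hu2 t ht
  have hi : IntervalIntegrable u volume a b := by
    have h1 : IntervalIntegrable (fun t => 1 + u t ^ 2) volume a b := intervalIntegrable_const.add hi2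
    rw [intervalIntegrable_iff_integrableOn_Icc_of_le hab] at h1 ⊢
    refine h1.mono' hmeas (ae_of_all _ fun t => ?_)
    rw [Real.norm_eq_abs]
    nlinarith [sq_abs (u t), sq_nonneg (|u t| - 1), abs_nonneg (u t)]
  rw [← x.integral_fderiv_vel S.isOpen_U S.contDiffOn_φ_one ha hab hb hxU]
  refine (sq_intervalIntegral_le hab hi hi2).trans ?_
  refine mul_le_mul_of_nonneg_left ?_ (sub_nonneg.2 hab)
  rw [energy, ← intervalIntegral.integral_const_mul]
  exact intervalIntegral.integral_mono_on hab hi2 (hE.const_mul _) hu2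

lemma energy_nonneg (x : H1Path (EuclideanSpace ℝ (Fin N))) {a b : ℝ} (hab : a ≤ b)
    (hx : ∀ s ∈ Icc a b, x.curve s ∈ S.U) : 0 ≤ S.energy x a b :=
  intervalIntegral.integral_nonneg hab fun t ht => S.g_nonneg (hx t ht) _

lemma energy_mono_right (x : H1Path (EuclideanSpace ℝ (Fin N))) {a b s : ℝ} (ha : 0 ≤ a)
    (has : a ≤ s) (hsb : s ≤ b) (hb : b ≤ 1) (hx : ∀ t ∈ Icc a b, x.curve t ∈ S.U) :
    S.energy x a s ≤ S.energy x a b := by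
  refine intervalIntegral.integral_mono_interval le_rfl has hsb ?_
    (S.intervalIntegrable_energy x ha (has.trans hsb) hb hx)
  filter_upwards [ae_restrict_mem measurableSet_Ioc] with t ht
  exact S.g_nonneg (hx t ⟨ht.1.le, ht.2⟩) _

/-- Every time at which a curve in `𝔐₀` is in `Ω` belongs to an interval of `ℐₓ`. -/
lemma exists_isMaxInner {x : H1Path (EuclideanSpace ℝ (Fin N))} (hx : x ∈ S.paths₀) {s : ℝ}
    (hs : s ∈ Icc (0 : ℝ) 1) (hneg : S.φ (x.curve s) < 0) :
    ∃ a b, S.IsMaxInner x a b ∧ s ∈ Icc a b := by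
  obtain ⟨hxU, hx0, hx1⟩ := hx
  -- Constant extension beyond `[0,1]` gives a globally continuous function.
  let f : ℝ → ℝ := IccExtend zero_le_one ((Icc (0 : ℝ) 1).domRestrict fun t => S.φ (x.curve t))
  have hf : Continuous f := by
    refine Continuous.Icc_extend' (continuousOn_iff_continuous_domRestrict.1 ?_)
    exact S.contDiffOn_φ.continuousOn.comp x.continuousOn_curve fun t ht => (hxU t ht).1
  have hfeq : ∀ t ∈ Icc (0 : ℝ) 1, f t = S.φ (x.curve t) := fun t ht => by
    simp [f, IccExtend_of_mem _ _ ht]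
  obtain ⟨a, ha, ha0, hau, hamin⟩ := exists_least_entrance hf hs.1
    (by rwa [hfeq 0 (by simp)]) (by rwa [hfeq s hs])
  -- Time reflection turns the largest exit time into a least entrance time; the right end is `-b`.
  obtain ⟨b, hb, hb0, hbu, hbmin⟩ := exists_least_entrance (f := fun t => f (-t)) (c := -1) (s := -s)
    (hf.comp continuous_neg) (by linarith [hs.2])
    (by simpa [hfeq 1 (by simp)] using hx1) (by simpa [hfeq s hs] using hneg)
  have hb' : -b ∈ Icc s 1 := ⟨by linarith [hb.2], by linarith [hb.1]⟩
  have hmem : ∀ t ∈ Icc a (-b), t ∈ Icc (0 : ℝ) 1 := fun t ht =>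
    ⟨ha.1.trans ht.1, ht.2.trans hb'.2⟩
  have ham : a ∈ Icc (0 : ℝ) 1 := ⟨ha.1, ha.2.trans hs.2⟩
  have hbm : -b ∈ Icc (0 : ℝ) 1 := ⟨hs.1.trans hb'.1, hb'.2⟩
  refine ⟨a, -b, ⟨⟨ha.1, ha.2.trans hb'.1, hb'.2, fun t ht => ⟨(hxU t (hmem t ht)).1, ?_⟩,
    ⟨(hxU a ham).1, by rwa [← hfeq a ham]⟩, ⟨(hxU _ hbm).1, by rwa [← hfeq _ hbm]⟩⟩,
    fun a' b' h' haa' hbb' => ?_⟩, ha.2, hb'.1⟩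
  · rw [← hfeq t (hmem t ht)]
    rcases le_total t s with h | h
    · exact hau t ⟨ht.1, h⟩
    · simpa using hbu (-t) ⟨by linarith [ht.2], by linarith⟩
  · obtain ⟨h1, h2, h3, h4, h5, h6⟩ := h'
    have hin : ∀ t ∈ Icc a' b', f t ≤ 0 := fun t ht => by
      rw [hfeq t ⟨h1.trans ht.1, ht.2.trans h3⟩]
      exact (h4 t ht).2
    refine ⟨le_antisymm haa' (hamin a' ⟨h1, haa'.trans ha.2⟩ ?_ fun u hu => ?_),
      le_antisymm ?_ hbb'⟩
    · rw [hfeq a' ⟨h1, h2.trans h3⟩]; exact h5.2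
    · exact hin u ⟨hu.1, hu.2.trans (hb'.1.trans hbb')⟩
    · have := hbmin (-b') ⟨by linarith, by linarith [hb'.1]⟩ ?_ fun u hu => ?_
      · linarith
      · rw [neg_neg, hfeq b' ⟨h1.trans h2, h3⟩]; exact h6.2
      · exact hin (-u) ⟨haa'.trans (ha.2.trans (by linarith [hu.2])), by linarith [hu.1]⟩

/-- A curve of `𝔐₀` whose inner intervals have small energy stays in the collar `{|φ| < δ₀}`. -/
lemma abs_φ_lt_of_energy_lt (hN : 2 ≤ N) {x : H1Path (EuclideanSpace ℝ (Fin N))}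
    (hx : x ∈ S.paths₀)
    (hE : ∀ a b, S.IsMaxInner x a b →
      (b - a) / 2 * S.energy x a b < 1 / 2 * (3 * S.δ₀ / (4 * S.K₀)) ^ 2)
    {s : ℝ} (hs : s ∈ Icc (0 : ℝ) 1) : |S.φ (x.curve s)| < S.δ₀ := by
  have hδ := S.δ₀_pos
  have hφ := (hx.1 s hs).2
  rcases le_or_gt 0 (S.φ (x.curve s)) with h | h
  · rwa [abs_of_nonneg h]
  obtain ⟨a, b, hmax, hsab⟩ := S.exists_isMaxInner hx hs h
  obtain ⟨h1, h2, h3, h4, h5, -⟩ := hmax.1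
  have hK := S.K₀_pos hN
  have hU : ∀ t ∈ Icc a b, x.curve t ∈ S.U := fun t ht => (h4 t ht).1
  have e1 := S.sq_sub_le_energy x h1 hsab.1 (hsab.2.trans h3) fun t ht =>
    have := h4 t ⟨ht.1, ht.2.trans hsab.2⟩
    ⟨this.1, this.2.trans hδ.le⟩
  rw [h5.2, sub_zero] at e1
  have e2 : (s - a) * (S.K₀ ^ 2 * S.energy x a s) ≤ (b - a) * (S.K₀ ^ 2 * S.energy x a b) := by
    have e3 := S.energy_mono_right x h1 hsab.1 hsab.2 h3 hU
    have e4 := S.energy_nonneg x hsab.1 fun t ht => hU t ⟨ht.1, ht.2.trans hsab.2⟩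
    have : a ≤ s := hsab.1
    have : s ≤ b := hsab.2
    gcongr
  -- The factor `2 K₀²` turns the energy bound into `(3δ₀/4)²`, which is below `δ₀²`.
  have e5 := mul_lt_mul_of_pos_left (hE a b hmax) (by positivity : 0 < 2 * S.K₀ ^ 2)
  have e6 : 2 * S.K₀ ^ 2 * (1 / 2 * (3 * S.δ₀ / (4 * S.K₀)) ^ 2) = (3 * S.δ₀ / 4) ^ 2 := by
    field_simp
  have e7 : S.φ (x.curve s) ^ 2 < S.δ₀ ^ 2 := by nlinarith
  exact abs_lt_of_sq_lt_sq e7 hδ.le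

end ConcaveDisk

/-! ### Extension of equivariant homotopies -/

/-- Let `M` be a retract of an open set. A homotopy of a closed swap-invariant `D ⊆ M × M`, given
by its first component, which starts at the identity and ends in the diagonal, extends (up to
its precise values) to an open neighbourhood of `D`. -/
lemma exists_homotopy_extension {E : Type*} [NormedAddCommGroup E] [NormedSpace ℝ E]
    [FiniteDimensional ℝ E] {M V : Set E} (hV : IsOpen V) (hMV : M ⊆ V) {r : E → E}
    (hr : ContinuousOn r V) (hrM : MapsTo r V M) (hrid : ∀ p ∈ M, r p = p)
    {D : Set (M × M)} (hD : IsClosed D) (hswap : ∀ p ∈ D, p.swap ∈ D)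
    {f : ℝ × (M × M) → E} (hf : ContinuousOn f (Icc 0 1 ×ˢ D))
    (hfM : MapsTo f (Icc 0 1 ×ˢ D) M) (hf0 : ∀ p ∈ D, f (0, p) = p.1)
    (hf1 : ∀ p ∈ D, f (1, p.swap) = f (1, p)) :
    ∃ (W : Set (M × M)) (F : ℝ → M × M → M), IsOpen W ∧ D ⊆ W ∧ (∀ p ∈ W, p.swap ∈ W) ∧
      ContinuousOn (fun z : ℝ × (M × M) => F z.1 z.2) (Icc 0 1 ×ˢ W) ∧
      (∀ p ∈ W, F 0 p = p.1) ∧ ∀ p ∈ W, F 1 p.swap = F 1 p := by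
  have : TietzeExtension E := TietzeExtension.of_tvs ℝ
  obtain ⟨e, he⟩ := ContinuousMap.exists_restrict_eq (isClosed_Icc.prod hD)
    ⟨_, continuousOn_iff_continuous_domRestrict.1 hf⟩
  have hef : ∀ z ∈ Icc (0 : ℝ) 1 ×ˢ D, e z = f z := fun z hz =>
    congrFun (congrArg DFunLike.coe he) ⟨z, hz⟩
  -- The Tietze extension is corrected, affinely in time, to start exactly at `p.1` and end
  -- swap-symmetrically. Both corrections vanish over `D`.
  let k : ℝ × (M × M) → E := fun z => e z + (1 - z.1) • ((z.2.1 : E) - e (0, z.2)) +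
    z.1 • ((1 / 2 : ℝ) • (e (1, z.2) + e (1, z.2.swap)) - e (1, z.2))
  have hk : Continuous k := by
    have := e.continuous
    dsimp only [k]
    fun_prop
  have hk0 : ∀ p, k (0, p) = p.1 := fun p => by simp [k]
  have hk1 : ∀ p, k (1, p) = (1 / 2 : ℝ) • (e (1, p) + e (1, p.swap)) := fun p => by simp [k]
  have hkD : ∀ z ∈ Icc (0 : ℝ) 1 ×ˢ D, k z ∈ M := by
    rintro ⟨τ, p⟩ ⟨hτ, hp⟩
    have h0 : e (0, p) = p.1 := (hef (0, p) ⟨by simp, hp⟩).trans (hf0 p hp)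
    have h1 : e (1, p.swap) = e (1, p) := by
      rw [hef (1, p) ⟨by simp, hp⟩, hef (1, p.swap) ⟨by simp, hswap p hp⟩, hf1 p hp]
    have h2 : k (τ, p) = e (τ, p) := by
      simp only [k, h0, h1, ← two_smul ℝ (e (1, p)), smul_smul]
      norm_num
    rw [h2, hef _ ⟨hτ, hp⟩]
    exact hfM ⟨hτ, hp⟩
  let W₀ : Set (M × M) := {p | ∀ τ ∈ Icc (0 : ℝ) 1, k (τ, p) ∈ V}
  have hW₀ : IsOpen W₀ := by
    rw [isOpen_iff_mem_nhds]
    intro p hp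
    -- Tube lemma over the compact time interval.
    refine isCompact_Icc.eventually_forall_of_forall_eventually fun τ hτ => ?_
    exact (hk.comp continuous_swap).continuousAt.eventually_mem (hV.mem_nhds (hp τ hτ))
  let W : Set (M × M) := W₀ ∩ Prod.swap ⁻¹' W₀
  have hDW : D ⊆ W₀ := fun p hp τ hτ => hMV (hkD _ ⟨hτ, hp⟩)
  classical
  let F : ℝ → M × M → M := fun τ p =>
    if h : k (τ, p) ∈ V then ⟨r (k (τ, p)), hrM h⟩ else p.1
  have hF : ∀ τ ∈ Icc (0 : ℝ) 1, ∀ p ∈ W, (F τ p : E) = r (k (τ, p)) := fun τ hτ p hp => by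
    simp only [F, dif_pos (hp.1 τ hτ)]
  have hWswap : ∀ p ∈ W, p.swap ∈ W := fun p hp => ⟨hp.2, by simpa using hp.1⟩
  refine ⟨W, F, hW₀.inter (hW₀.preimage continuous_swap), fun p hp => ⟨hDW hp, hDW (hswap p hp)⟩,
    hWswap, ?_, fun p hp => Subtype.ext ?_, fun p hp => Subtype.ext ?_⟩
  · rw [Topology.IsInducing.subtypeVal.continuousOn_iff]
    refine (hr.comp hk.continuousOn fun z hz => hz.2.1 z.1 hz.1).congr fun z hz => ?_
    exact hF z.1 hz.1 z.2 hz.2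
  · rw [hF 0 (by simp) p hp, hk0, hrid _ p.1.2]
  · rw [hF 1 (by simp) p hp, hF 1 (by simp) _ (hWswap p hp), hk1, hk1, Prod.swap_swap, add_comm]

/-- A homotopy as in `exists_homotopy_extension` shows that the image of `D` in the quotient by
the swap has relative category `0` with respect to the diagonal. -/
lemma relCoverable_zero_of_homotopy {M X : Type*} [TopologicalSpace M] [TopologicalSpace X]
    {Q : M × M → X} (hQ : IsOpenQuotientMap Q)
    (hQeq : ∀ p p', Q p = Q p' ↔ p' = p ∨ p' = p.swap) {D W : Set (M × M)} (hW : IsOpen W)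
    (hDW : D ⊆ W) (hWswap : ∀ p ∈ W, p.swap ∈ W) {F : ℝ → M × M → M}
    (hF : ContinuousOn (fun z : ℝ × (M × M) => F z.1 z.2) (Icc 0 1 ×ˢ W))
    (hF0 : ∀ p ∈ W, F 0 p = p.1) (hF1 : ∀ p ∈ W, F 1 p.swap = F 1 p) :
    RelCoverable (Q '' {p | p.1 = p.2}) (Q '' D) 0 := by
  let rep : X → M × M := Function.surjInv hQ.surjective
  -- The second point moves as the first point of the swapped pair, so the motion commutes with the
  -- swap and descends to the quotient.
  let H : ℝ → X → X := fun τ x => Q (F τ (rep x), F τ (rep x).swap)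
  have hH : ∀ τ p, H τ (Q p) = Q (F τ p, F τ p.swap) := by
    intro τ p
    rcases (hQeq _ _).1 (Function.surjInv_eq hQ.surjective (Q p)).symm with h | h
    · change Q (F τ (rep (Q p)), _) = _
      rw [show rep (Q p) = p from h]
    · change Q (F τ (rep (Q p)), F τ (rep (Q p)).swap) = _
      rw [show rep (Q p) = p.swap from h, Prod.swap_swap]
      exact (hQeq _ _).2 (Or.inr rfl)
  have hpre : ∀ p, Q p ∈ Q '' W → p ∈ W := by
    rintro p ⟨p', hp', he⟩
    rcases (hQeq _ _).1 he with rfl | rfl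
    · exact hp'
    · exact hWswap _ hp'
  refine ⟨fun _ => Q '' W, fun _ => H, ?_, ?_, fun i _ => ⟨hQ.isOpenMap _ hW, ?_, ?_⟩,
    fun i h1 h2 => by omega, ?_, ?_⟩
  · exact (image_mono hDW).trans (subset_biUnion_of_mem (u := fun _ => Q '' W) (mem_Iic.2 le_rfl))
  · exact inter_subset_left.trans (image_mono hDW)
  · rintro ⟨τ, _⟩ ⟨hτ, p, hp, rfl⟩
    -- Openness of `Q` keeps the product with time a quotient map; as `W` is saturated, continuity
    -- can be checked upstairs.
    have hid : IsOpenQuotientMap (Prod.map id Q : ℝ × (M × M) → ℝ × X) :=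
      IsOpenQuotientMap.id.prodMap hQ
    have hnhds : 𝓝[Icc (0 : ℝ) 1 ×ˢ (Q '' W)] (τ, Q p) =
        map (Prod.map id Q) (𝓝[Icc (0 : ℝ) 1 ×ˢ W] (τ, p)) := by
      have hpm : (Prod.map id Q : ℝ × (M × M) → ℝ × X) ⁻¹' (Icc (0 : ℝ) 1 ×ˢ (Q '' W)) =
          Icc (0 : ℝ) 1 ×ˢ W := by
        ext ⟨σ, p'⟩
        exact and_congr_right fun _ => ⟨fun h => hpre _ h, fun h => mem_image_of_mem _ h⟩
      rw [nhdsWithin, nhdsWithin, ← hpm, map_inf_principal_preimage, hid.map_nhds_eq]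
      rfl
    rw [ContinuousWithinAt, hnhds, tendsto_map'_iff]
    change Tendsto (fun z : ℝ × (M × M) => H z.1 (Q z.2)) _ (𝓝 (H τ (Q p)))
    simp only [hH]
    have h1 : ContinuousWithinAt (fun z : ℝ × (M × M) => F z.1 z.2) (Icc 0 1 ×ˢ W) (τ, p) :=
      hF _ ⟨hτ, hp⟩
    have h2 : ContinuousWithinAt (fun z : ℝ × (M × M) => F z.1 z.2.swap) (Icc 0 1 ×ˢ W) (τ, p) :=
      (hF.comp (f := fun z : ℝ × (M × M) => (z.1, z.2.swap))
        (continuous_fst.prodMk (continuous_swap.comp continuous_snd)).continuousOn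
        fun z hz => ⟨hz.1, hWswap _ hz.2⟩) (τ, p) ⟨hτ, hp⟩
    exact (hQ.continuous.tendsto _).comp (h1.prodMk h2).tendsto
  · rintro _ ⟨p, hp, rfl⟩
    change H 0 (Q p) = Q p
    rw [hH, hF0 p hp, hF0 _ (hWswap p hp)]
    rfl
  · rintro _ ⟨p, hp, rfl⟩
    change H 1 (Q p) ∈ _
    rw [hH]
    exact ⟨_, (hF1 p hp).symm, rfl⟩
  · rintro τ - _ ⟨-, p, hp, rfl⟩
    change H τ (Q p) ∈ _
    rw [hH]
    refine ⟨_, ?_, rfl⟩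
    -- Over the diagonal both points follow the same track.
    have : p.swap = p := Prod.ext (Eq.symm hp) hp
    simp only [mem_ofPred_eq, this]

/-! ### The chord space modulo reversal, and its deformation into constant chords -/

namespace ConcaveDisk

variable {N : ℕ} {S : ConcaveDisk N}

namespace ChordMap

variable (G : S.ChordMap)

/-- The chord joining two points of `∂Ω`, up to time reversal. -/
def quotMk (p : S.bdry × S.bdry) : G.ChordQuot :=
  Quotient.mk G.chordSetoid ⟨G.toFun p.1 p.2, p.1, p.2, rfl⟩

lemma toFun_injective {p p' : S.bdry × S.bdry} (h : G.toFun p.1 p.2 = G.toFun p'.1 p'.2) :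
    p = p' := by
  refine Prod.ext (Subtype.ext ?_) (Subtype.ext ?_)
  · rw [← G.curve_zero p.1 p.2, h, G.curve_zero]
  · rw [← G.curve_one p.1 p.2, h, G.curve_one]

lemma quotMk_eq_iff (p p' : S.bdry × S.bdry) :
    G.quotMk p = G.quotMk p' ↔ p' = p ∨ p' = p.swap := by
  rw [quotMk, quotMk, Quotient.eq]
  change (G.toFun p'.1 p'.2 = G.toFun p.1 p.2 ∨ G.toFun p'.1 p'.2 = (G.toFun p.1 p.2).reverse) ↔ _
  rw [G.reverse_eq]
  refine or_congr ⟨fun h => G.toFun_injective h, fun h => by rw [h]⟩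
    ⟨fun h => G.toFun_injective (p' := p.swap) h, fun h => by rw [h]; rfl⟩

/-- Chords are determined by their end points. -/
def chordHomeo : S.bdry × S.bdry ≃ₜ G.chords where
  toFun p := ⟨G.toFun p.1 p.2, p.1, p.2, rfl⟩
  invFun x := (⟨x.1.curve 0, by obtain ⟨_, A, B, rfl⟩ := x; rw [G.curve_zero]; exact A.2⟩,
    ⟨x.1.curve 1, by obtain ⟨_, A, B, rfl⟩ := x; rw [G.curve_one]; exact B.2⟩)
  left_inv p := Prod.ext (Subtype.ext (G.curve_zero _ _)) (Subtype.ext (G.curve_one _ _))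
  right_inv := by
    rintro ⟨_, A, B, rfl⟩
    simp only [G.curve_zero, G.curve_one]
  continuous_toFun := G.continuous.subtype_mk _
  continuous_invFun := by
    have h : ∀ s ∈ Icc (0 : ℝ) 1, Continuous fun x : G.chords => x.1.curve s := fun s hs =>
      H1Path.continuousOn_eval.comp_continuous (f := fun x : G.chords => (x.1, s)) (by fun_prop)
        fun x => ⟨mem_univ _, hs⟩
    exact ((h 0 (by simp)).subtype_mk _).prodMk ((h 1 (by simp)).subtype_mk _)

/-- The saturation of an open `W` is the open set `W ∪ swap⁻¹ W`. -/
lemma isOpenQuotientMap_quotMk : IsOpenQuotientMap G.quotMk := by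
  have hq : IsQuotientMap G.quotMk :=
    (isQuotientMap_quotient_mk' (s := G.chordSetoid)).comp G.chordHomeo.isQuotientMap
  refine ⟨hq.surjective, hq.continuous, fun W hW => ?_⟩
  rw [← hq.isOpen_preimage]
  have : G.quotMk ⁻¹' (G.quotMk '' W) = W ∪ Prod.swap ⁻¹' W := by
    ext p
    simp only [mem_preimage, mem_image, G.quotMk_eq_iff, mem_union]
    constructor
    · rintro ⟨p', hp', rfl | rfl⟩
      · exact Or.inl hp'
      · exact Or.inr (by simpa using hp')
    · rintro (h | h)
      · exact ⟨p, h, Or.inl rfl⟩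
      · exact ⟨p.swap, h, Or.inr (by simp)⟩
  rw [this]
  exact hW.union (hW.preimage continuous_swap)

lemma toQuot_eq_image {D : Set (H1Path (EuclideanSpace ℝ (Fin N)))} :
    G.toQuot D = G.quotMk '' {p | G.toFun p.1 p.2 ∈ D} := by
  ext q
  constructor
  · rintro ⟨⟨_, A, B, rfl⟩, hx, rfl⟩
    exact ⟨(A, B), hx, rfl⟩
  · rintro ⟨p, hp, rfl⟩
    exact ⟨⟨G.toFun p.1 p.2, p.1, p.2, rfl⟩, hp, rfl⟩

lemma setOf_mem_constChords : {p : S.bdry × S.bdry | G.toFun p.1 p.2 ∈ G.constChords} =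
    {p | p.1 = p.2} := by
  ext p
  constructor
  · rintro ⟨A, hA⟩
    have := G.toFun_injective (p' := (A, A)) hA
    rw [this]
    rfl
  · intro h
    exact ⟨p.1, by rw [show p.2 = p.1 from h.symm]⟩

/-- A set of chords carrying an admissible homotopy that ends in the collar of `∂Ω` can be
deformed into the constant chords. -/
lemma relCoverable_zero {D : Set (H1Path (EuclideanSpace ℝ (Fin N)))}
    {h : ℝ → H1Path (EuclideanSpace ℝ (Fin N)) → H1Path (EuclideanSpace ℝ (Fin N))}
    (hh : G.IsAdmissible D h)
    (hnear : ∀ x ∈ D, ∀ s ∈ Icc (0 : ℝ) 1, |S.φ ((h 1 x).curve s)| < S.δ₀) :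
    RelCoverable (G.toQuot G.constChords) (G.toQuot D) 0 := by
  have hδ := S.δ₀_pos
  have hK : IsCompact {p | p ∈ S.U ∧ |S.φ p| ≤ S.δ₀} := by
    have hsub : {p | p ∈ S.U ∧ S.φ p ≤ S.δ₀} ⊆ S.U := fun p hp => hp.1
    have hcl := (S.contDiffOn_φ.continuousOn.mono hsub).preimage_isClosed_of_isClosed
      S.isCompact_sublevel.isClosed (isClosed_Ici (a := -S.δ₀))
    have : {p | p ∈ S.U ∧ |S.φ p| ≤ S.δ₀} =
        {p | p ∈ S.U ∧ S.φ p ≤ S.δ₀} ∩ S.φ ⁻¹' Ici (-S.δ₀) := by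
      ext p
      simp only [mem_ofPred_eq, mem_inter_iff, mem_preimage, mem_Ici, abs_le]
      tauto
    rw [this]
    exact S.isCompact_sublevel.of_isClosed_subset hcl inter_subset_left
  obtain ⟨r, hr, hrM, hrid⟩ := exists_retraction_zeroSet S.isOpen_U S.contDiffOn_φ_one hδ hK
    fun p hp hp' => S.fderiv_ne_zero hp hp'
  have hVo : IsOpen (S.U ∩ S.φ ⁻¹' Ioo (-S.δ₀) S.δ₀) :=
    S.contDiffOn_φ.continuousOn.isOpen_inter_preimage S.isOpen_U isOpen_Ioo
  have hVK : S.U ∩ S.φ ⁻¹' Ioo (-S.δ₀) S.δ₀ ⊆ {p | p ∈ S.U ∧ |S.φ p| ≤ S.δ₀} :=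
    fun p hp => ⟨hp.1, abs_le.2 ⟨hp.2.1.le, hp.2.2.le⟩⟩
  have hswapD : ∀ x ∈ D, x.reverse ∈ D := fun x hx => hh.dom.2.2 ▸ mem_image_of_mem _ hx
  -- For `τ ≤ 1/2` this is the initial point of `h (2τ) x`; afterwards it runs along `h 1 x` to the
  -- midpoint. The truncations express the concatenation in one formula.
  let c : ℝ × (S.bdry × S.bdry) → EuclideanSpace ℝ (Fin N) := fun z =>
    (h (min (2 * z.1) 1) (G.toFun z.2.1 z.2.2)).curve (max (z.1 - 1 / 2) 0)
  let D' : Set (S.bdry × S.bdry) := {p | G.toFun p.1 p.2 ∈ D}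
  have hmin : ∀ τ ∈ Icc (0 : ℝ) 1, min (2 * τ) 1 ∈ Icc (0 : ℝ) 1 := fun τ hτ =>
    ⟨le_min (by linarith [hτ.1]) zero_le_one, min_le_right _ _⟩
  have hmax : ∀ τ ∈ Icc (0 : ℝ) 1, max (τ - 1 / 2) 0 ∈ Icc (0 : ℝ) 1 := fun τ hτ =>
    ⟨le_max_right _ _, max_le (by linarith [hτ.2]) zero_le_one⟩
  have hc : ContinuousOn c (Icc 0 1 ×ˢ D') := by
    refine H1Path.continuousOn_eval.comp (f := fun z : ℝ × (S.bdry × S.bdry) =>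
      (h (min (2 * z.1) 1) (G.toFun z.2.1 z.2.2), max (z.1 - 1 / 2) 0)) ?_
      fun z hz => ⟨mem_univ _, hmax _ hz.1⟩
    refine ContinuousOn.prodMk ?_ (by fun_prop)
    refine hh.continuousOn.comp (f := fun z : ℝ × (S.bdry × S.bdry) =>
      (min (2 * z.1) 1, G.toFun z.2.1 z.2.2)) ?_ fun z hz => ⟨hmin _ hz.1, hz.2⟩
    exact ContinuousOn.prodMk (by fun_prop) (G.continuous.comp continuous_snd).continuousOn
  have hcK : MapsTo c (Icc 0 1 ×ˢ D') {p | p ∈ S.U ∧ |S.φ p| ≤ S.δ₀} := by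
    rintro ⟨τ, p⟩ ⟨hτ, hp⟩
    have hpath := (hh.mem_paths _ (hmin τ hτ) _ hp).1
    have h1 := hpath.1 _ (hmax τ hτ)
    refine ⟨h1.1, ?_⟩
    -- In the first half, initial points of curves in `𝔐₀` satisfy `0 ≤ φ < δ₀`; in the second half
    -- `hnear` applies.
    rcases le_total τ (1 / 2) with hle | hle
    · have e : max (τ - 1 / 2) 0 = 0 := max_eq_right (by linarith)
      simp only [c, e] at h1 ⊢
      rw [abs_of_nonneg hpath.2.1]
      exact h1.2.le
    · have e : min (2 * τ) 1 = 1 := min_eq_right (by linarith)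
      simp only [c, e]
      exact (hnear _ hp _ (hmax τ hτ)).le
  obtain ⟨W, F, hW, hDW, hWswap, hF, hF0, hF1⟩ := exists_homotopy_extension (M := S.bdry) (r := r)
    (D := D') (f := fun z => r (c z)) hVo
    (fun p hp => ⟨hp.1, by
      have := hp.2
      simp only [mem_preimage, this, mem_Ioo]
      exact ⟨by linarith, hδ⟩⟩)
    (hr.mono hVK) (fun p hp => hrM p (hVK hp).1 (hVK hp).2) (fun p hp => hrid p hp.1 hp.2)
    (hh.dom.2.1.preimage G.continuous)
    (fun p hp => by
      have := hswapD _ hp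
      rwa [G.reverse_eq] at this)
    (hr.comp hc hcK) (fun z hz => hrM _ (hcK hz).1 (hcK hz).2)
    (fun p hp => by
      have e : c (0, p) = p.1 := by
        simp only [c]
        norm_num
        rw [hh.start _ hp, G.curve_zero]
      rw [e]
      exact hrid _ p.1.2.1 p.1.2.2)
    (fun p hp => by
      -- Reversal fixes the midpoint, so both tracks end at the same point.
      have e : c (1, p.swap) = c (1, p) := by
        simp only [c, Prod.fst_swap, Prod.snd_swap]
        rw [← G.reverse_eq p.1 p.2]
        norm_num
        rw [hh.equivariant 1 (by simp) _ hp, H1Path.curve_reverse _ (by norm_num)]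
        norm_num
      simp only [e])
  rw [G.toQuot_eq_image, G.toQuot_eq_image, G.setOf_mem_constChords]
  exact relCoverable_zero_of_homotopy G.isOpenQuotientMap_quotMk G.quotMk_eq_iff hW hDW hWswap
    hF hF0 hF1

end ChordMap

end ConcaveDisk

end OrthogonalChords
end
-- The minimax levels
open OrthogonalChords in
theorem lemma12p3 (N : ℕ) (hN : 2 ≤ N) (S : ConcaveDisk N) (G : S.ChordMap)
    (δb γb σ₁ : ℝ) (hδb : 0 < δb) (hδb' : δb < S.δ₀) (hγb : 0 < γb)
    (hσ₁ : 0 < σ₁) (hσ₁' : σ₁ < δb / 2) :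
    0 < 1 / 2 * (3 * S.δ₀ / (4 * S.K₀)) ^ 2 ∧
    ENNReal.ofReal (1 / 2 * (3 * S.δ₀ / (4 * S.K₀)) ^ 2) ≤ G.level δb γb σ₁ 1 ∧
    ∀ i, 1 ≤ i → i < N → G.level δb γb σ₁ i ≤ G.level δb γb σ₁ (i + 1) := by
  have hδ := S.δ₀_pos
  have hK := S.K₀_pos hN
  have hpos : 0 < 1 / 2 * (3 * S.δ₀ / (4 * S.K₀)) ^ 2 := by positivity
  refine ⟨hpos, ?_, fun i _ _ => ?_⟩
  · refine le_iInf fun D => le_iInf fun h => le_iInf fun hD => le_iInf fun hh => ?_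
    by_contra! hlt
    have hcov : RelCoverable (G.toQuot G.constChords) (G.toQuot D) 0 := by
      refine G.relCoverable_zero hh.toIsAdmissible fun x hx s hs => ?_
      refine S.abs_φ_lt_of_energy_lt hN (hh.mem_paths 1 (by simp) x hx).1 (fun a b hab => ?_) hs
      have hle : ENNReal.ofReal ((b - a) / 2 * S.energy (h 1 x) a b) ≤
          ConcaveDisk.ChordMap.Func S D h :=
        le_iSup₂_of_le x hx (le_iSup_of_le a (le_iSup_of_le b (le_iSup_of_le hab le_rfl)))
      exact (ENNReal.ofReal_lt_ofReal_iff hpos).1 (hle.trans_lt hlt)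
    have h1 : relCat (G.toQuot G.constChords) (G.toQuot D) ≤ ((0 : ℕ) : ℕ∞) := iInf₂_le 0 hcov
    have h2 := hD.2.trans h1
    simp at h2
  -- `Γ_{i+1} ⊆ Γ_i`, so the infimum defining `c_i` runs over more pairs.
  · refine iInf_mono fun D => iInf_mono fun h => iInf_mono' fun hD => ⟨⟨hD.1, ?_⟩, le_rfl⟩
    exact le_trans (by exact_mod_cast Nat.le_succ i) hD.2
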